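/- Let $SG(0)$ be a triangle, and let $SG(n+1)$ be obtained from three copies of $SG(n)$ (lower left, lower right, top) by identifying their outmost vertices pairwise, as in the usual construction of the two-dimensional Sierpinski gasket; $SG(n)$ has $3^{n+1}$ edges and $\tfrac32(3^n+1)$ vertices. All stages are placed with the same leftmost vertex $o$, so that $SG(k)\subseteq SG(N)$ for $k\le N$ is the sub-triangle at $o$. Let $a_n$ and $b_n$ be the rightmost and the topmost vertex of $SG(n)$, and let $c_n$ be the vertex of $SG(n+1)$ such that $a_n,b_n,c_n$ are the corners of the largest lacunary triangle of $SG(n+1)$. For a vertex $x$ of $SG(N)$ let $F_j(N,x)=f_j(N,x)/f(N)$, where $f(N)$ is the number of spanning trees of $SG(N)$ and $f_j(N,x)$ is the number of those in which $x$ has degree $j$. Then for all integers $n,m\ge 0$: \begin{align*} F_1(n+m+1,a_n) &= \tfrac{1815}{5488}\left(\tfrac{3}{5}\right)^n - \tfrac{99}{1372}\left(\tfrac{1}{25}\right)^n + \tfrac{55}{16464}\left(\tfrac{1}{375}\right)^n + \left(\tfrac{1}{15}\right)^m\Bigl\{ - \tfrac{121}{5488}\left(\tfrac{3}{5}\right)^n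 - \tfrac{22}{1029}\left(\tfrac{1}{25}\right)^n + \tfrac{185}{49392}\left(\tfrac{1}{375}\right)^n \Bigr\} ,\\ F_2(n+m+1,a_n) &= \tfrac{121}{196} - \tfrac{825}{5488}\left(\tfrac{3}{5}\right)^n + \tfrac{171}{1372}\left(\tfrac{1}{25}\right)^n - \tfrac{55}{5488}\left(\tfrac{1}{375}\right)^n - \tfrac{121}{1176}\left(\tfrac{1}{15}\right)^n + \tfrac{1}{294}\left(\tfrac{1}{225}\right)^n + \left(\tfrac{1}{15}\right)^m\Bigl\{ \tfrac{55}{5488}\left(\tfrac{3}{5}\right)^n + \tfrac{38}{1029}\left(\tfrac{1}{25}\right)^n - \tfrac{185}{16464}\left(\tfrac{1}{375}\right)^n - \tfrac{143}{3528}\left(\tfrac{1}{15}\right)^n + \tfrac{11}{2646}\left(\tfrac{1}{225}\right)^n \Bigr\} ,\\ F_3(n+m+1,a_n) &= \tfrac{33}{98} - \tfrac{855}{5488}\left(\tfrac{3}{5}\right)^n - \tfrac{45}{1372}\left(\tfrac{1}{25}\right)^n + \tfrac{55}{5488}\left(\tfrac{1}{375}\right)^n + \tfrac{11}{147}\left(\tfrac{1}{15}\right)^n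 - \tfrac{1}{147}\left(\tfrac{1}{225}\right)^n + \left(\tfrac{1}{15}\right)^m\Bigl\{ \tfrac{57}{5488}\left(\tfrac{3}{5}\right)^n - \tfrac{10}{1029}\left(\tfrac{1}{25}\right)^n + \tfrac{185}{16464}\left(\tfrac{1}{375}\right)^n + \tfrac{13}{441}\left(\tfrac{1}{15}\right)^n - \tfrac{11}{1323}\left(\tfrac{1}{225}\right)^n \Bigr\} ,\\ F_4(n+m+1,a_n) &= \tfrac{9}{196} - \tfrac{135}{5488}\left(\tfrac{3}{5}\right)^n - \tfrac{27}{1372}\left(\tfrac{1}{25}\right)^n - \tfrac{55}{16464}\left(\tfrac{1}{375}\right)^n + \tfrac{11}{392}\left(\tfrac{1}{15}\right)^n + \tfrac{1}{294}\left(\tfrac{1}{225}\right)^n + \left(\tfrac{1}{15}\right)^m\Bigl\{ \tfrac{9}{5488}\left(\tfrac{3}{5}\right)^n - \tfrac{2}{343}\left(\tfrac{1}{25}\right)^n - \tfrac{185}{49392}\left(\tfrac{1}{375}\right)^n + \tfrac{13}{1176}\left(\tfrac{1}{15}\right)^n + \tfrac{11}{2646}\left(\tfrac{1}{225}\right)^n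 \Bigr\} ,\\ F_1(n+m+1,c_n) &= \tfrac{1089}{2744}\left(\tfrac{3}{5}\right)^n - \tfrac{22}{343}\left(\tfrac{1}{25}\right)^n + \tfrac{5}{8232}\left(\tfrac{1}{375}\right)^n + \left(\tfrac{1}{15}\right)^m\Bigl\{ - \tfrac{121}{1372}\left(\tfrac{3}{5}\right)^n - \tfrac{121}{4116}\left(\tfrac{1}{25}\right)^n + \tfrac{20}{3087}\left(\tfrac{1}{375}\right)^n \Bigr\} ,\\ F_2(n+m+1,c_n) &= \tfrac{121}{196} - \tfrac{495}{2744}\left(\tfrac{3}{5}\right)^n + \tfrac{38}{343}\left(\tfrac{1}{25}\right)^n - \tfrac{5}{2744}\left(\tfrac{1}{375}\right)^n - \tfrac{55}{588}\left(\tfrac{1}{15}\right)^n + \left(\tfrac{1}{15}\right)^m\Bigl\{ \tfrac{55}{1372}\left(\tfrac{3}{5}\right)^n + \tfrac{209}{4116}\left(\tfrac{1}{25}\right)^n - \tfrac{20}{1029}\left(\tfrac{1}{375}\right)^n - \tfrac{22}{441}\left(\tfrac{1}{15}\right)^n + \tfrac{10}{1323}\left(\tfrac{1}{225}\right)^n \Bigr\}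 ,\\ F_3(n+m+1,c_n) &= \tfrac{33}{98} - \tfrac{513}{2744}\left(\tfrac{3}{5}\right)^n - \tfrac{10}{343}\left(\tfrac{1}{25}\right)^n + \tfrac{5}{2744}\left(\tfrac{1}{375}\right)^n + \tfrac{10}{147}\left(\tfrac{1}{15}\right)^n + \left(\tfrac{1}{15}\right)^m\Bigl\{ \tfrac{57}{1372}\left(\tfrac{3}{5}\right)^n - \tfrac{55}{4116}\left(\tfrac{1}{25}\right)^n + \tfrac{20}{1029}\left(\tfrac{1}{375}\right)^n + \tfrac{16}{441}\left(\tfrac{1}{15}\right)^n - \tfrac{20}{1323}\left(\tfrac{1}{225}\right)^n \Bigr\} ,\\ F_4(n+m+1,c_n) &= \tfrac{9}{196} - \tfrac{81}{2744}\left(\tfrac{3}{5}\right)^n - \tfrac{6}{343}\left(\tfrac{1}{25}\right)^n - \tfrac{5}{8232}\left(\tfrac{1}{375}\right)^n + \tfrac{5}{196}\left(\tfrac{1}{15}\right)^n + \left(\tfrac{1}{15}\right)^m\Bigl\{ \tfrac{9}{1372}\left(\tfrac{3}{5}\right)^n - \tfrac{11}{1372}\left(\tfrac{1}{25}\right)^n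 - \tfrac{20}{3087}\left(\tfrac{1}{375}\right)^n + \tfrac{2}{147}\left(\tfrac{1}{15}\right)^n + \tfrac{10}{1323}\left(\tfrac{1}{225}\right)^n \Bigr\} . \end{align*} -/

import Mathlib

namespace SierpinskiGasket

/-- The vertices of `SG(n)`, in the triangular lattice. The pair `(p, q)` stands for the point
`p + q * exp (i * π / 3)` of the plane, so `(1, 0)` is a unit step to the right and `(0, 1)` a unit
step to the upper right. Stage `0` is a triangle; stage `n + 1` consists of three copies of stage
`n`, the lower left, the lower right and the upper one. -/
def verts : ℕ → Finset (ℕ × ℕ)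
  | 0 => {(0, 0), (1, 0), (0, 1)}
  | n + 1 =>
      verts n ∪ (verts n).image (fun p => p + (2 ^ n, 0)) ∪ (verts n).image (fun p => p + (0, 2 ^ n))

/-- The edges of `SG(n)`, given by the same recursion. -/
def edges : ℕ → Finset (Sym2 (ℕ × ℕ))
  | 0 => {s((0, 0), (1, 0)), s((0, 0), (0, 1)), s((1, 0), (0, 1))}
  | n + 1 =>
      edges n ∪ (edges n).image (Sym2.map (fun p => p + (2 ^ n, 0))) ∪
        (edges n).image (Sym2.map (fun p => p + (0, 2 ^ n)))

/-- The vertex set of `SG(n)` as a type. -/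
abbrev Vertex (n : ℕ) : Type := {p : ℕ × ℕ // p ∈ verts n}

/-- The Sierpinski gasket graph `SG(n)`. -/
def SG (n : ℕ) : SimpleGraph (Vertex n) :=
  (SimpleGraph.fromEdgeSet (edges n : Set (Sym2 (ℕ × ℕ)))).comap Subtype.val

/-- The spanning trees of `SG(n)`: the spanning subgraphs that are trees. -/
def spanningTrees (n : ℕ) : Set (SimpleGraph (Vertex n)) :=
  {T | T ≤ SG n ∧ T.IsTree}

/-- `f(n)`, the number of spanning trees of `SG(n)`. -/
noncomputable def f (n : ℕ) : ℕ := (spanningTrees n).ncard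

/-- `f_j(n, x)`, the number of spanning trees of `SG(n)` in which exactly `j` edges are
attached to the vertex `x`. -/
noncomputable def fdeg (j n : ℕ) (x : Vertex n) : ℕ :=
  {T ∈ spanningTrees n | (T.neighborSet x).ncard = j}.ncard

/-- `F_j(n, x) = f_j(n, x) / f(n)`, the probability that the vertex `x` has degree `j` in a
uniformly chosen spanning tree of `SG(n)`. -/
noncomputable def F (j n : ℕ) (x : Vertex n) : ℝ := (fdeg j n x : ℝ) / (f n : ℝ)

theorem verts_subset_succ (n : ℕ) : verts n ⊆ verts (n + 1) := by
  intro p hp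
  simp [verts, hp]

theorem verts_mono {k n : ℕ} (h : k ≤ n) : verts k ⊆ verts n := by
  induction h with
  | refl => exact Finset.Subset.refl _
  | step _ ih => exact ih.trans (verts_subset_succ _)

theorem corner_mem (n : ℕ) : (2 ^ n, 0) ∈ verts n ∧ (0, 2 ^ n) ∈ verts n := by
  induction n with
  | zero => simp [verts]
  | succ n ih =>
    constructor
    · refine Finset.mem_union_left _ (Finset.mem_union_right _ ?_)
      exact Finset.mem_image.2 ⟨_, ih.1, by ext <;> simp [pow_succ, mul_two]⟩
    · refine Finset.mem_union_right _ ?_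
      exact Finset.mem_image.2 ⟨_, ih.2, by ext <;> simp [pow_succ, mul_two]⟩

theorem a_mem (n m : ℕ) : (2 ^ n, 0) ∈ verts (n + m + 1) :=
  verts_mono (by omega) (corner_mem n).1

theorem c_mem (n m : ℕ) : (2 ^ n, 2 ^ n) ∈ verts (n + m + 1) := by
  refine verts_mono (show n + 1 ≤ n + m + 1 by omega) ?_
  refine Finset.mem_union_right _ ?_
  exact Finset.mem_image.2 ⟨_, (corner_mem n).1, by ext <;> simp⟩

/-- `a_n` as a vertex of `SG(n + m + 1)`: the rightmost vertex of the copy of `SG(n)` at the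
leftmost vertex `o = (0, 0)`. -/
def a (n m : ℕ) : Vertex (n + m + 1) := ⟨(2 ^ n, 0), a_mem n m⟩

/-- `c_n` as a vertex of `SG(n + m + 1)`: together with `a_n` and the topmost vertex
`b_n = (0, 2 ^ n)` of the copy of `SG(n)` at `o`, it spans the largest lacunary triangle of the copy
of `SG(n + 1)` at `o`. -/
def c (n m : ℕ) : Vertex (n + m + 1) := ⟨(2 ^ n, 2 ^ n), c_mem n m⟩

end SierpinskiGasket

/-!
A spanning tree of `SG(n + 1)` restricts to a spanning forest on each of the three copies of
`SG(n)`. Each component of such a forest contains a corner, so up to its type, the partition of the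
three corners that it induces, a forest of `SG(n + 1)` is an arbitrary triple of forests of `SG(n)`
with compatible types. The numbers of forests of the different types keep fixed ratios, up to one
factor, depending on `n`, for each additional component. Since all compatible triples have the same
total number of components, the law of the three types given the type of their union is the same at
all stages.

Weight each edge at a vertex `x` by `y`, so that the mean weight of a uniform spanning tree is the
generating function of the degree of `x`. If `x` is a corner, only one copy contains it, and the
mean weights of the types evolve linearly with the stage, with eigenvalues `1`, `1 / 15`, `3 / 5`
and `1 / 25`. The vertices `a_n` and `c_n` are corners of two copies of `SG(n)` in `SG(n + 1)`, and
from stage `n + 1` on they lie in the left copy only, which brings in the powers of `1 / 15` with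
exponent `m`. The degree law is read off from the coefficients in `y`.
-/

namespace SierpinskiGasket

/-- The lower left, the lower right and the upper corner of the unit triangle. -/
def unitCorner : Fin 3 → ℕ × ℕ := ![(0, 0), (1, 0), (0, 1)]

/-- The left, the right and the top corner of `SG(n)`. -/
def corner (n : ℕ) (j : Fin 3) : ℕ × ℕ := 2 ^ n • unitCorner j

/-- The translation onto the `i`-th copy of `SG(n)` in `SG(n + 1)`, in which `corner n i` becomes
`corner (n + 1) i`. -/
def shift (n : ℕ) (i : Fin 3) (p : ℕ × ℕ) : ℕ × ℕ := p + corner n i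

theorem shift_injective (n : ℕ) (i : Fin 3) : Function.Injective (shift n i) :=
  add_left_injective _

theorem map_shift_injective (n : ℕ) (i : Fin 3) : Function.Injective (Sym2.map (shift n i)) :=
  Sym2.map.injective (shift_injective n i)

theorem shift_corner_comm (n : ℕ) (i j : Fin 3) :
    shift n i (corner n j) = shift n j (corner n i) :=
  add_comm _ _

theorem shift_corner_self (n : ℕ) (i : Fin 3) : shift n i (corner n i) = corner (n + 1) i := by
  simp only [shift, corner, pow_succ, mul_two, add_smul]

theorem corner_zero (n : ℕ) : corner n 0 = (0, 0) := by simp [corner, unitCorner]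

theorem corner_one (n : ℕ) : corner n 1 = (2 ^ n, 0) := by simp [corner, unitCorner]

theorem corner_two (n : ℕ) : corner n 2 = (0, 2 ^ n) := by simp [corner, unitCorner]

theorem shift_zero (n : ℕ) : shift n 0 = id := by
  funext p
  rw [shift, corner_zero, id_eq, ← Prod.zero_eq_mk, add_zero]

theorem shift_one (n : ℕ) : shift n 1 = fun p => p + (2 ^ n, 0) := by
  funext p
  rw [shift, corner_one]

theorem shift_two (n : ℕ) : shift n 2 = fun p => p + (0, 2 ^ n) := by
  funext p
  rw [shift, corner_two]

theorem corner_injective (n : ℕ) : Function.Injective (corner n) := by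
  have hunit : Function.Injective unitCorner := by decide
  exact (smul_right_injective (ℕ × ℕ) (pow_ne_zero n two_ne_zero)).comp hunit

theorem verts_succ (n : ℕ) :
    verts (n + 1) = Finset.univ.biUnion fun i => (verts n).image (shift n i) := by
  ext p
  simp only [verts, Finset.mem_union, Finset.mem_biUnion, Finset.mem_univ, true_and,
    Fin.exists_fin_succ, Fin.succ_zero_eq_one, Fin.succ_one_eq_two, shift_zero, shift_one,
    shift_two, Finset.image_id, IsEmpty.exists_iff, or_false, or_assoc]

theorem edges_succ (n : ℕ) :
    edges (n + 1) = Finset.univ.biUnion fun i => (edges n).image (Sym2.map (shift n i)) := by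
  ext e
  simp only [edges, Finset.mem_union, Finset.mem_biUnion, Finset.mem_univ, true_and,
    Fin.exists_fin_succ, Fin.succ_zero_eq_one, Fin.succ_one_eq_two, shift_zero, shift_one,
    shift_two, Sym2.map_id, Finset.image_id, IsEmpty.exists_iff, or_false, or_assoc]

theorem mem_verts_succ {n : ℕ} {p : ℕ × ℕ} :
    p ∈ verts (n + 1) ↔ ∃ i, ∃ u ∈ verts n, shift n i u = p := by
  simp only [verts_succ, Finset.mem_biUnion, Finset.mem_univ, true_and, Finset.mem_image]

theorem mem_edges_succ {n : ℕ} {e : Sym2 (ℕ × ℕ)} :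
    e ∈ edges (n + 1) ↔ ∃ i, ∃ d ∈ edges n, d.map (shift n i) = e := by
  simp only [edges_succ, Finset.mem_biUnion, Finset.mem_univ, true_and, Finset.mem_image]

theorem corner_mem_verts (n : ℕ) (j : Fin 3) : corner n j ∈ verts n := by
  induction n with
  | zero => revert j; decide
  | succ n ih => exact mem_verts_succ.2 ⟨j, _, ih, shift_corner_self n j⟩

theorem mem_verts_zero {v : ℕ × ℕ} : v ∈ verts 0 ↔ ∃ j, corner 0 j = v := by
  have huniv : verts 0 = Finset.univ.image (corner 0) := by decide
  simp only [huniv, Finset.mem_image, Finset.mem_univ, true_and]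

theorem add_le_of_mem_verts {n : ℕ} {p : ℕ × ℕ} (hp : p ∈ verts n) : p.1 + p.2 ≤ 2 ^ n := by
  induction n generalizing p with
  | zero =>
    obtain ⟨j, rfl⟩ := mem_verts_zero.1 hp
    revert j
    decide
  | succ n ih =>
    obtain ⟨i, u, hu, rfl⟩ := mem_verts_succ.1 hp
    have hu := ih hu
    rw [pow_succ]
    fin_cases i <;> simp only [shift, Fin.zero_eta, Fin.mk_one, Fin.reduceFinMk, corner_zero,
      corner_one, corner_two, Prod.fst_add, Prod.snd_add] <;> omega

theorem eq_corner_of_shift_eq {n : ℕ} {i j : Fin 3} (hij : i ≠ j) {u v : ℕ × ℕ}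
    (hu : u ∈ verts n) (hv : v ∈ verts n) (h : shift n i u = shift n j v) :
    u = corner n j ∧ v = corner n i := by
  have hu := add_le_of_mem_verts hu
  have hv := add_le_of_mem_verts hv
  simp only [shift, Prod.ext_iff, Prod.fst_add, Prod.snd_add] at h ⊢
  fin_cases i <;> fin_cases j <;> first
    | exact absurd rfl hij
    | simp only [Fin.zero_eta, Fin.mk_one, Fin.reduceFinMk, corner_zero, corner_one,
        corner_two] at h ⊢
      omega

theorem image_shift_inter_image_shift (n : ℕ) {i j : Fin 3} (hij : i ≠ j) :
    (verts n).image (shift n i) ∩ (verts n).image (shift n j) = {shift n i (corner n j)} := by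
  ext p
  simp only [Finset.mem_inter, Finset.mem_image, Finset.mem_singleton]
  constructor
  · rintro ⟨⟨u, hu, rfl⟩, v, hv, h⟩
    rw [(eq_corner_of_shift_eq hij hu hv h.symm).1]
  · rintro rfl
    exact ⟨⟨_, corner_mem_verts n j, rfl⟩, _, corner_mem_verts n i, shift_corner_comm n j i⟩

theorem card_verts_succ (n : ℕ) : (verts (n + 1)).card + 3 = 3 * (verts n).card := by
  have hcard (i : Fin 3) : ((verts n).image (shift n i)).card = (verts n).card :=
    Finset.card_image_of_injective _ (shift_injective n i)
  have hunion : verts (n + 1) = ((verts n).image (shift n 0) ∪ (verts n).image (shift n 1)) ∪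
      (verts n).image (shift n 2) := by
    rw [verts, shift_zero, shift_one, shift_two, Finset.image_id]
  have hne : shift n 0 (corner n 2) ≠ shift n 1 (corner n 2) := by
    simp only [shift, ne_eq, add_right_inj, (corner_injective n).eq_iff, zero_ne_one,
      not_false_eq_true]
  have hlower := Finset.card_union_add_card_inter
    ((verts n).image (shift n 0)) ((verts n).image (shift n 1))
  have hupper := Finset.card_union_add_card_inter
    ((verts n).image (shift n 0) ∪ (verts n).image (shift n 1)) ((verts n).image (shift n 2))
  rw [image_shift_inter_image_shift n (by decide), Finset.card_singleton] at hlower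
  rw [Finset.union_inter_distrib_right, image_shift_inter_image_shift n (by decide),
    image_shift_inter_image_shift n (by decide), Finset.singleton_union, Finset.card_pair hne,
    ← hunion] at hupper
  simp only [hcard] at hlower hupper
  omega

theorem mem_verts_of_mem_edges {n : ℕ} {e : Sym2 (ℕ × ℕ)} (he : e ∈ edges n) {p : ℕ × ℕ}
    (hp : p ∈ e) : p ∈ verts n := by
  induction n generalizing e p with
  | zero =>
    have hsub : edges 0 ⊆ (verts 0).sym2 := by decide
    exact Finset.mem_sym2_iff.1 (hsub he) p hp
  | succ n ih =>
    obtain ⟨i, d, hd, rfl⟩ := mem_edges_succ.1 he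
    obtain ⟨q, hq, rfl⟩ := Sym2.mem_map.1 hp
    exact mem_verts_succ.2 ⟨i, q, ih hd hq, rfl⟩

theorem not_isDiag_of_mem_edges {n : ℕ} {e : Sym2 (ℕ × ℕ)} (he : e ∈ edges n) : ¬ e.IsDiag := by
  induction n generalizing e with
  | zero =>
    revert e
    decide
  | succ n ih =>
    obtain ⟨i, d, hd, rfl⟩ := mem_edges_succ.1 he
    rw [Sym2.isDiag_map (shift_injective n i)]
    exact ih hd

theorem map_shift_ne_map_shift {n : ℕ} {i j : Fin 3} (hij : i ≠ j) {d e : Sym2 (ℕ × ℕ)}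
    (hd : d ∈ edges n) (he : e ∈ edges n) : d.map (shift n i) ≠ e.map (shift n j) := by
  intro h
  have heq : ∀ p ∈ d, p = corner n j := by
    intro p hp
    have hmem : shift n i p ∈ e.map (shift n j) := h ▸ Sym2.mem_map.2 ⟨p, hp, rfl⟩
    obtain ⟨q, hq, hqp⟩ := Sym2.mem_map.1 hmem
    exact (eq_corner_of_shift_eq hij (mem_verts_of_mem_edges hd hp)
      (mem_verts_of_mem_edges he hq) hqp.symm).1
  apply not_isDiag_of_mem_edges hd
  induction d with
  | _ p q =>
    rw [Sym2.mk_isDiag_iff, heq p (Sym2.mem_mk_left p q), heq q (Sym2.mem_mk_right p q)]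

theorem eq_of_eqvGen {α β : Type*} {r : α → α → Prop} {g : α → β} (hg : ∀ a b, r a b → g a = g b)
    {x y : α} (h : Relation.EqvGen r x y) : g x = g y :=
  (Setoid.ker g).iseqv.eqvGen_iff.1 (Relation.EqvGen.mono hg _ _ h)

section Representative

variable {α : Type*} [DecidableEq α]

/-- A choice of representatives of the classes of the equivalence relation generated by a list of
pairs: each pair in turn has its two classes merged. It makes finite connectivity questions
decidable. -/
def representative (l : List (α × α)) : α → α :=
  l.foldr (fun p g x => if g x = g p.1 then g p.2 else g x) id

theorem representative_eq_iff {l : List (α × α)} {x y : α} :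
    representative l x = representative l y ↔ Relation.EqvGen (fun a b => (a, b) ∈ l) x y := by
  induction l generalizing x y with
  | nil =>
    exact ⟨fun (h : x = y) => h ▸ .refl x, eq_of_eqvGen fun a b h => absurd h List.not_mem_nil⟩
  | cons p l ih =>
    have hcons (z : α) : representative (p :: l) z =
      if representative l z = representative l p.1 then representative l p.2
      else representative l z := rfl
    have hmono {a b : α} (h : representative l a = representative l b) :
        Relation.EqvGen (fun a b => (a, b) ∈ p :: l) a b :=
      Relation.EqvGen.mono (fun _ _ => List.mem_cons_of_mem p) _ _ (ih.1 h)
    have hp : Relation.EqvGen (fun a b => (a, b) ∈ p :: l) p.1 p.2 := .rel _ _ List.mem_cons_self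
    constructor
    · intro h
      rw [hcons, hcons] at h
      split_ifs at h with hx hy hy
      · exact hmono (hx.trans hy.symm)
      · exact ((hmono hx).trans _ _ _ hp).trans _ _ _ (hmono h)
      · exact (hmono h).trans _ _ _ ((hmono hy).trans _ _ _ hp).symm
      · exact hmono h
    · refine eq_of_eqvGen fun a b h => ?_
      rcases List.mem_cons.1 h with rfl | h
      · simp only [hcons, if_true, ite_self]
      · rw [hcons, hcons, ih.2 (.rel _ _ h)]

theorem reflTransGen_iff_representative {r : α → α → Prop} [DecidableRel r] [Std.Symm r]
    {l : List α} (hl : ∀ a b, r a b → a ∈ l) {x y : α} :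
    Relation.ReflTransGen r x y ↔
      representative ((l ×ˢ l).filter fun p => r p.1 p.2) x =
        representative ((l ×ˢ l).filter fun p => r p.1 p.2) y := by
  have hmem : (fun a b => (a, b) ∈ (l ×ˢ l).filter fun p => r p.1 p.2) = r := by
    ext a b
    simp only [List.mem_filter, List.mem_product, decide_eq_true_eq, and_iff_right_iff_imp]
    exact fun h => ⟨hl a b h, hl b a (symm_of r h)⟩
  rw [representative_eq_iff, hmem, Relation.EqvGen.eqvGen_eq_reflTransGen]

end Representative

/-- The partitions of the three corners `0`, `1`, `2` of a stage of the gasket: one block, corner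
`i` separated from the two others, or three singletons. -/
inductive CornerPart
  | tree
  | iso (i : Fin 3)
  | discrete
  deriving DecidableEq, Fintype

namespace CornerPart

/-- The relation of lying in the same block. -/
def rel : CornerPart → Fin 3 → Fin 3 → Bool
  | tree, _, _ => true
  | iso i, j, k => (j == i) == (k == i)
  | discrete, j, k => j == k

/-- The number of blocks. -/
def blocks : CornerPart → ℕ
  | tree => 1
  | iso _ => 2
  | discrete => 3

/-- The weight of a type in the gluing recursion: it makes the number of forests of `SG(n)` of type
`π` equal to `T * r ^ π.blocks * π.mult`, where `T` and `r` depend only on `n`. -/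
def mult : CornerPart → ℕ
  | tree => 1
  | iso _ => 1
  | discrete => 3

theorem rel_symm {π : CornerPart} {j k : Fin 3} (h : π.rel j k = true) : π.rel k j = true := by
  revert π j k
  decide

theorem rel_injective : Function.Injective rel := by
  intro π ρ
  revert π ρ
  decide +kernel

theorem exists_rel_iff_of_equivalence {r : Fin 3 → Fin 3 → Prop} (hr : Equivalence r) :
    ∃ π : CornerPart, ∀ j k, r j k ↔ π.rel j k = true := by
  classical
  have hbool : ∀ r : Fin 3 → Fin 3 → Bool, (∀ j, r j j) → (∀ j k, r j k → r k j) →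
      (∀ j k l, r j k → r k l → r j l) → ∃ π : CornerPart, ∀ j k, r j k = π.rel j k := by
    decide +kernel
  obtain ⟨π, hπ⟩ := hbool (fun j k => decide (r j k)) (by simpa using hr.refl)
    (by simpa using fun j k => hr.symm) (by simpa using fun j k l => hr.trans)
  exact ⟨π, fun j k => by rw [← hπ, decide_eq_true_eq]⟩

end CornerPart

/-- Connectivity by the edges in `S`. -/
def Reach {V : Type*} (S : Finset (Sym2 V)) : V → V → Prop :=
  Relation.ReflTransGen fun u v => s(u, v) ∈ S

namespace Reach

variable {V : Type*} {S : Finset (Sym2 V)} {u v w : V}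

instance : Std.Symm fun u v : V => s(u, v) ∈ S where
  symm _ _ h := Sym2.eq_swap ▸ h

theorem refl : Reach S u u := Relation.ReflTransGen.refl

theorem symm (h : Reach S u v) : Reach S v u := symm_of (Relation.ReflTransGen _) h

theorem trans (h : Reach S u v) (h' : Reach S v w) : Reach S u w :=
  Relation.ReflTransGen.trans h h'

end Reach

/-- The components of the edge set `S` all contain a corner of `SG(n)`, and they partition the
corners according to `π`. -/
structure Covers (n : ℕ) (S : Finset (Sym2 (ℕ × ℕ))) (π : CornerPart) : Prop where
  exists_corner : ∀ v ∈ verts n, ∃ j, Reach S (corner n j) v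
  reach_iff : ∀ j k, Reach S (corner n j) (corner n k) ↔ π.rel j k = true

theorem Covers.unique {n : ℕ} {S : Finset (Sym2 (ℕ × ℕ))} {π ρ : CornerPart} (h : Covers n S π)
    (h' : Covers n S ρ) : π = ρ :=
  CornerPart.rel_injective <| funext₂ fun j k =>
    Bool.eq_iff_iff.2 ((h.reach_iff j k).symm.trans (h'.reach_iff j k))

theorem exists_covers {n : ℕ} {S : Finset (Sym2 (ℕ × ℕ))}
    (h : ∀ v ∈ verts n, ∃ j, Reach S (corner n j) v) : ∃ π, Covers n S π := by
  obtain ⟨π, hπ⟩ := CornerPart.exists_rel_iff_of_equivalence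
    (r := fun j k => Reach S (corner n j) (corner n k)) ⟨fun _ => .refl, .symm, .trans⟩
  exact ⟨π, h, hπ⟩

/-- The union of three edge sets, placed in the three copies of `SG(n)` in `SG(n + 1)`. -/
def glueEdges (n : ℕ) (S : Fin 3 → Finset (Sym2 (ℕ × ℕ))) : Finset (Sym2 (ℕ × ℕ)) :=
  Finset.univ.biUnion fun i => (S i).image (Sym2.map (shift n i))

/-- The part of an edge set of `SG(n + 1)` that lies in the `i`-th copy of `SG(n)`, as an edge set
of `SG(n)`. -/
def restrictEdges (n : ℕ) (S : Finset (Sym2 (ℕ × ℕ))) (i : Fin 3) : Finset (Sym2 (ℕ × ℕ)) :=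
  (edges n).filter fun d => d.map (shift n i) ∈ S

theorem mem_glueEdges {n : ℕ} {S : Fin 3 → Finset (Sym2 (ℕ × ℕ))} {e : Sym2 (ℕ × ℕ)} :
    e ∈ glueEdges n S ↔ ∃ i, ∃ d ∈ S i, d.map (shift n i) = e := by
  simp only [glueEdges, Finset.mem_biUnion, Finset.mem_univ, true_and, Finset.mem_image]

theorem mk_mem_glueEdges {n : ℕ} {S : Fin 3 → Finset (Sym2 (ℕ × ℕ))} {v w : ℕ × ℕ} :
    s(v, w) ∈ glueEdges n S ↔ ∃ i a b, s(a, b) ∈ S i ∧ shift n i a = v ∧ shift n i b = w := by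
  rw [mem_glueEdges]
  constructor
  · rintro ⟨i, d, hd, h⟩
    induction d with
    | _ a b =>
      rcases Sym2.eq_iff.1 h with ⟨ha, hb⟩ | ⟨ha, hb⟩
      · exact ⟨i, a, b, hd, ha, hb⟩
      · exact ⟨i, b, a, Sym2.eq_swap ▸ hd, hb, ha⟩
  · rintro ⟨i, a, b, hab, rfl, rfl⟩
    exact ⟨i, _, hab, rfl⟩

theorem restrictEdges_subset (n : ℕ) (S : Finset (Sym2 (ℕ × ℕ))) (i : Fin 3) :
    restrictEdges n S i ⊆ edges n :=
  Finset.filter_subset _ _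

theorem glueEdges_restrictEdges {n : ℕ} {S : Finset (Sym2 (ℕ × ℕ))} (hS : S ⊆ edges (n + 1)) :
    glueEdges n (restrictEdges n S) = S := by
  ext e
  rw [mem_glueEdges]
  constructor
  · rintro ⟨i, d, hd, rfl⟩
    exact (Finset.mem_filter.1 hd).2
  · intro he
    obtain ⟨i, d, hd, rfl⟩ := mem_edges_succ.1 (hS he)
    exact ⟨i, d, Finset.mem_filter.2 ⟨hd, he⟩, rfl⟩

section Glue

variable {n : ℕ} {S : Fin 3 → Finset (Sym2 (ℕ × ℕ))}

theorem glueEdges_subset (hS : ∀ i, S i ⊆ edges n) : glueEdges n S ⊆ edges (n + 1) := by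
  intro e he
  obtain ⟨i, d, hd, rfl⟩ := mem_glueEdges.1 he
  exact mem_edges_succ.2 ⟨i, d, hS i hd, rfl⟩

theorem restrictEdges_glueEdges (hS : ∀ i, S i ⊆ edges n) :
    restrictEdges n (glueEdges n S) = S := by
  funext i
  ext e
  rw [restrictEdges, Finset.mem_filter, mem_glueEdges]
  constructor
  · rintro ⟨he, j, d, hd, h⟩
    obtain rfl : j = i := not_imp_comm.1 (map_shift_ne_map_shift · (hS j hd) he) (not_not.2 h)
    rwa [← map_shift_injective n _ h]
  · exact fun he => ⟨hS i he, i, e, he, rfl⟩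

theorem pairwiseDisjoint_image_map_shift (hS : ∀ i, S i ⊆ edges n) :
    (↑(Finset.univ : Finset (Fin 3)) : Set (Fin 3)).PairwiseDisjoint fun i =>
      (S i).image (Sym2.map (shift n i)) := by
  intro i _ j _ hij
  rw [Function.onFun, Finset.disjoint_left]
  intro e he he'
  obtain ⟨d, hd, rfl⟩ := Finset.mem_image.1 he
  obtain ⟨d', hd', h⟩ := Finset.mem_image.1 he'
  exact map_shift_ne_map_shift hij (hS i hd) (hS j hd') h.symm

theorem prod_glueEdges (hS : ∀ i, S i ⊆ edges n) {M : Type*} [CommMonoid M]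
    (w : Sym2 (ℕ × ℕ) → M) :
    ∏ e ∈ glueEdges n S, w e = ∏ i, ∏ e ∈ S i, w (e.map (shift n i)) := by
  rw [glueEdges, Finset.prod_biUnion (pairwiseDisjoint_image_map_shift hS)]
  exact Finset.prod_congr rfl fun i _ => Finset.prod_image (map_shift_injective n i).injOn

theorem card_glueEdges (hS : ∀ i, S i ⊆ edges n) :
    (glueEdges n S).card = ∑ i, (S i).card := by
  rw [glueEdges, Finset.card_biUnion fun i hi j hj hij =>
    pairwiseDisjoint_image_map_shift hS hi hj hij]
  exact Finset.sum_congr rfl fun i _ => Finset.card_image_of_injective _ (map_shift_injective n i)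

/-- One step between the corners of the three copies of a stage, where `(i, j)` stands for corner
`j` of copy `i`. It either stays within a copy `i` and moves along `R i`, or uses that corner `j`
of copy `i` is corner `i` of copy `j`. -/
def JunctionStep (R : Fin 3 → Fin 3 → Fin 3 → Prop) (p q : Fin 3 × Fin 3) : Prop :=
  (p.1 = q.1 ∧ R p.1 p.2 q.2) ∨ q = p.swap

instance (R : Fin 3 → Fin 3 → Fin 3 → Prop) [∀ i, DecidableRel (R i)] :
    DecidableRel (JunctionStep R) :=
  fun _ _ => inferInstanceAs (Decidable (_ ∨ _))

/-- Connectivity between the corners of the three copies of a stage, when the corners of copy `i`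
are connected by `R i`. -/
def JunctionReach (R : Fin 3 → Fin 3 → Fin 3 → Prop) :
    Fin 3 × Fin 3 → Fin 3 × Fin 3 → Prop :=
  Relation.ReflTransGen (JunctionStep R)

namespace JunctionReach

variable {R : Fin 3 → Fin 3 → Fin 3 → Prop} {p : Fin 3 × Fin 3} {i j k : Fin 3}

theorem copy (h : JunctionReach R p (i, j)) (hR : R i j k) : JunctionReach R p (i, k) :=
  h.tail (.inl ⟨rfl, hR⟩)

theorem swap (h : JunctionReach R p (i, j)) : JunctionReach R p (j, i) :=
  h.tail (.inr rfl)

end JunctionReach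

/-- Connectivity between corners of copy `i` by the edge set `S i`. -/
def CornersReach (n : ℕ) (S : Fin 3 → Finset (Sym2 (ℕ × ℕ))) (i j k : Fin 3) : Prop :=
  Reach (S i) (corner n j) (corner n k)

/-- The vertex `u` of copy `i` is connected by `S i` to some corner of this copy that is connected
to `p` in the graph of corners. -/
def CopyReach (n : ℕ) (S : Fin 3 → Finset (Sym2 (ℕ × ℕ))) (p : Fin 3 × Fin 3) (i : Fin 3)
    (u : ℕ × ℕ) : Prop :=
  ∃ j, JunctionReach (CornersReach n S) p (i, j) ∧ Reach (S i) (corner n j) u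

theorem CopyReach.of_shift_eq {p : Fin 3 × Fin 3} {i i' : Fin 3} {u u' : ℕ × ℕ}
    (h : CopyReach n S p i u) (hu : u ∈ verts n) (hu' : u' ∈ verts n)
    (heq : shift n i u = shift n i' u') : CopyReach n S p i' u' := by
  by_cases hi : i = i'
  · subst hi
    rwa [← shift_injective n i heq]
  · obtain ⟨rfl, rfl⟩ := eq_corner_of_shift_eq hi hu hu' heq
    obtain ⟨j, hpj, hju⟩ := h
    exact ⟨i, (hpj.copy hju).swap, .refl⟩

theorem CopyReach.of_reach (hS : ∀ i, S i ⊆ edges n) {p : Fin 3 × Fin 3} {i : Fin 3} {u : ℕ × ℕ}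
    (hu : u ∈ verts n)
    (h : Reach (glueEdges n S) (shift n p.1 (corner n p.2)) (shift n i u)) :
    CopyReach n S p i u := by
  generalize hv : shift n i u = v at h
  induction h generalizing i u with
  | refl =>
    have hp : CopyReach n S p p.1 (corner n p.2) := ⟨p.2, .refl, .refl⟩
    exact hp.of_shift_eq (corner_mem_verts n p.2) hu hv.symm
  | tail _ hvw ih =>
    obtain ⟨i', a, b, hab, ha, rfl⟩ := mk_mem_glueEdges.1 hvw
    obtain ⟨j, hpj, hja⟩ := ih (mem_verts_of_mem_edges (hS i' hab) (Sym2.mem_mk_left a b)) ha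
    have hb : CopyReach n S p i' b := ⟨j, hpj, hja.tail hab⟩
    exact hb.of_shift_eq (mem_verts_of_mem_edges (hS i' hab) (Sym2.mem_mk_right a b)) hu hv.symm

theorem Reach.glue {i : Fin 3} {u v : ℕ × ℕ} (h : Reach (S i) u v) :
    Reach (glueEdges n S) (shift n i u) (shift n i v) :=
  Relation.ReflTransGen.lift (shift n i)
    (fun _ _ huv => mk_mem_glueEdges.2 ⟨i, _, _, huv, rfl, rfl⟩) _ _ h

theorem reach_glueEdges_iff (hS : ∀ i, S i ⊆ edges n) (p q : Fin 3 × Fin 3) :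
    Reach (glueEdges n S) (shift n p.1 (corner n p.2)) (shift n q.1 (corner n q.2)) ↔
      JunctionReach (CornersReach n S) p q := by
  constructor
  · intro h
    obtain ⟨j, hpj, hjq⟩ := CopyReach.of_reach hS (corner_mem_verts n q.2) h
    exact hpj.copy hjq
  · intro h
    induction h with
    | refl => exact .refl
    | @tail q r _ hqr ih =>
      rcases hqr with ⟨hcopy, hreach⟩ | rfl
      · rw [← hcopy]
        exact ih.trans hreach.glue
      · rwa [Prod.fst_swap, Prod.snd_swap, shift_corner_comm n q.2]

/-- If the corners of copy `i` are partitioned according to `ρ i`, then every corner of a copy is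
connected to an outer corner, and the outer corners are partitioned according to `π`. -/
def Glues (ρ : Fin 3 → CornerPart) (π : CornerPart) : Prop :=
  (∀ p, ∃ l, JunctionReach (fun i j k => (ρ i).rel j k = true) (l, l) p) ∧
    ∀ j k, JunctionReach (fun i j k => (ρ i).rel j k = true) (j, j) (k, k) ↔ π.rel j k = true

theorem covers_glueEdges_iff_glues (hS : ∀ i, S i ⊆ edges n) {ρ : Fin 3 → CornerPart}
    (hρ : ∀ i, Covers n (S i) (ρ i)) (π : CornerPart) :
    Covers (n + 1) (glueEdges n S) π ↔ Glues ρ π := by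
  have hrel : CornersReach n S = fun i j k => (ρ i).rel j k = true := by
    ext i j k
    exact (hρ i).reach_iff j k
  have hreach (l : Fin 3) (p : Fin 3 × Fin 3) :
      Reach (glueEdges n S) (corner (n + 1) l) (shift n p.1 (corner n p.2)) ↔
        JunctionReach (fun i j k => (ρ i).rel j k = true) (l, l) p := by
    rw [← shift_corner_self, ← hrel]
    exact reach_glueEdges_iff hS (l, l) p
  constructor
  · intro h
    refine ⟨fun p => ?_, fun j k => ?_⟩
    · simpa only [hreach] using
        h.exists_corner _ (mem_verts_succ.2 ⟨p.1, _, corner_mem_verts n p.2, rfl⟩)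
    · rw [← h.reach_iff, ← shift_corner_self n k, ← hreach j (k, k)]
  · rintro ⟨hcorner, hglue⟩
    refine ⟨fun v hv => ?_, fun j k => ?_⟩
    · obtain ⟨i, u, hu, rfl⟩ := mem_verts_succ.1 hv
      obtain ⟨j, hj⟩ := (hρ i).exists_corner u hu
      obtain ⟨l, hl⟩ := hcorner (i, j)
      exact ⟨l, ((hreach l (i, j)).2 hl).trans hj.glue⟩
    · rw [← hglue, ← shift_corner_self n k, ← hreach j (k, k)]

theorem covers_glueEdges_iff (hS : ∀ i, S i ⊆ edges n) (π : CornerPart) :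
    Covers (n + 1) (glueEdges n S) π ↔
      ∃ ρ : Fin 3 → CornerPart, (∀ i, Covers n (S i) (ρ i)) ∧ Glues ρ π := by
  constructor
  · intro h
    have hcovers (i : Fin 3) : ∃ ρ, Covers n (S i) ρ := by
      refine exists_covers fun v hv => ?_
      obtain ⟨l, hl⟩ := h.exists_corner _ (mem_verts_succ.2 ⟨i, v, hv, rfl⟩)
      rw [← shift_corner_self] at hl
      obtain ⟨j, -, hj⟩ := CopyReach.of_reach (p := (l, l)) hS hv hl
      exact ⟨j, hj⟩
    choose ρ hρ using hcovers
    exact ⟨ρ, hρ, (covers_glueEdges_iff_glues hS hρ π).1 h⟩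
  · rintro ⟨ρ, hρ, hglue⟩
    exact (covers_glueEdges_iff_glues hS hρ π).2 hglue

end Glue

instance junctionStepSymm (ρ : Fin 3 → CornerPart) :
    Std.Symm (JunctionStep fun i j k => (ρ i).rel j k = true) where
  symm p q := by
    rintro (⟨hpq, hrel⟩ | rfl)
    · exact .inl ⟨hpq.symm, hpq ▸ CornerPart.rel_symm hrel⟩
    · exact .inr p.swap_swap.symm

instance decidableJunctionReach (ρ : Fin 3 → CornerPart) :
    DecidableRel (JunctionReach fun i j k => (ρ i).rel j k = true) := fun _ _ =>
  decidable_of_iff _ (reflTransGen_iff_representative (l := List.finRange 3 ×ˢ List.finRange 3)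
    fun p _ _ => List.mem_product.2 ⟨List.mem_finRange p.1, List.mem_finRange p.2⟩).symm

instance decidableGlues (ρ : Fin 3 → CornerPart) (π : CornerPart) : Decidable (Glues ρ π) :=
  inferInstanceAs (Decidable (_ ∧ _))

theorem Glues.sum_blocks_le {ρ : Fin 3 → CornerPart} {π : CornerPart} (h : Glues ρ π) :
    ∑ i, (ρ i).blocks ≤ 3 + π.blocks := by
  revert ρ π
  decide +kernel

theorem covers_zero_iff {S : Finset (Sym2 (ℕ × ℕ))} {π : CornerPart} :
    Covers 0 S π ↔ ∀ j k, Reach S (corner 0 j) (corner 0 k) ↔ π.rel j k = true := by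
  refine ⟨Covers.reach_iff, fun h => ⟨fun v hv => ?_, h⟩⟩
  obtain ⟨j, rfl⟩ := mem_verts_zero.1 hv
  exact ⟨j, .refl⟩

instance decidableReachZero (S : (edges 0).powerset) : DecidableRel (Reach S.1) := fun _ _ =>
  decidable_of_iff _ (reflTransGen_iff_representative (l := [(0, 0), (1, 0), (0, 1)])
    fun u v huv => by
      simpa only [verts, Finset.mem_insert, Finset.mem_singleton, List.mem_cons, List.not_mem_nil,
        or_false] using mem_verts_of_mem_edges (Finset.mem_powerset.1 S.2 huv)
          (Sym2.mem_mk_left u v)).symm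

instance decidableCoversZero (S : (edges 0).powerset) (π : CornerPart) :
    Decidable (Covers 0 S.1 π) :=
  decidable_of_iff _ covers_zero_iff.symm

theorem card_verts_zero : (verts 0).card = 3 := by decide

theorem Covers.card_verts_le {n : ℕ} {S : Finset (Sym2 (ℕ × ℕ))} (hS : S ⊆ edges n)
    {π : CornerPart} (h : Covers n S π) : (verts n).card ≤ S.card + π.blocks := by
  induction n generalizing S π with
  | zero =>
    have htriangle : ∀ (S : (edges 0).powerset) (π : CornerPart), Covers 0 S.1 π →
        3 ≤ S.1.card + π.blocks := by
      decide +kernel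
    rw [card_verts_zero]
    exact htriangle ⟨S, Finset.mem_powerset.2 hS⟩ π h
  | succ n ih =>
    have hR := restrictEdges_subset n S
    rw [← glueEdges_restrictEdges hS] at h ⊢
    obtain ⟨ρ, hρ, hglue⟩ := (covers_glueEdges_iff hR π).1 h
    have hsum := Finset.sum_le_sum fun i (_ : i ∈ Finset.univ) => ih (hR i) (hρ i)
    rw [Finset.sum_add_distrib, Finset.sum_const, Finset.card_univ, Fintype.card_fin, smul_eq_mul,
      ← card_glueEdges hR, ← card_verts_succ] at hsum
    have hblocks := hglue.sum_blocks_le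
    omega

/-- `S` is the edge set of a spanning forest of `SG(n)`, each component of which contains a corner,
and the components partition the corners according to `π`. Acyclicity is expressed by the number of
edges. -/
structure IsForest (n : ℕ) (S : Finset (Sym2 (ℕ × ℕ))) (π : CornerPart) : Prop
    extends Covers n S π where
  subset : S ⊆ edges n
  card_eq : S.card + π.blocks = (verts n).card

/-- The types of three forests of `SG(n)` whose union is a forest of `SG(n + 1)` of type `π`. The
condition on the numbers of blocks says that gluing closes no cycle. -/
def admissible (π : CornerPart) : Finset (Fin 3 → CornerPart) :=
  Finset.univ.filter fun ρ => ∑ i, (ρ i).blocks = 3 + π.blocks ∧ Glues ρ π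

theorem isForest_glueEdges_iff {n : ℕ} {S : Fin 3 → Finset (Sym2 (ℕ × ℕ))}
    (hS : ∀ i, S i ⊆ edges n) {π : CornerPart} :
    IsForest (n + 1) (glueEdges n S) π ↔ ∃ ρ ∈ admissible π, ∀ i, IsForest n (S i) (ρ i) := by
  have hverts : (verts (n + 1)).card + 3 = ∑ _ : Fin 3, (verts n).card := by
    rw [card_verts_succ, Fin.sum_const, smul_eq_mul]
  have hcard := card_glueEdges hS
  constructor
  · intro h
    obtain ⟨ρ, hρ, hglue⟩ := (covers_glueEdges_iff hS π).1 h.toCovers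
    have hle (i : Fin 3) := (hρ i).card_verts_le (hS i)
    have hle_sum := Finset.sum_le_sum fun i (_ : i ∈ Finset.univ) => hle i
    have hblocks := hglue.sum_blocks_le
    have htotal := h.card_eq
    have hsum := Finset.sum_add_distrib (s := Finset.univ) (f := fun i => (S i).card)
      (g := fun i => (ρ i).blocks)
    refine ⟨ρ, Finset.mem_filter.2 ⟨Finset.mem_univ ρ, by omega, hglue⟩, fun i =>
      ⟨hρ i, hS i, ?_⟩⟩
    have heq := (Finset.sum_eq_sum_iff_of_le fun i (_ : i ∈ Finset.univ) => hle i).1 (by omega)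
    exact (heq i (Finset.mem_univ i)).symm
  · rintro ⟨ρ, hρ, hforest⟩
    obtain ⟨-, hblocks, hglue⟩ := Finset.mem_filter.1 hρ
    refine ⟨(covers_glueEdges_iff hS π).2 ⟨ρ, fun i => (hforest i).toCovers, hglue⟩,
      glueEdges_subset hS, ?_⟩
    have hsum := Finset.sum_congr rfl fun i (_ : i ∈ Finset.univ) => (hforest i).card_eq
    rw [Finset.sum_add_distrib] at hsum
    omega

open scoped Classical in
/-- The edge sets of the spanning forests of `SG(n)` of type `π`. -/
noncomputable def forests (n : ℕ) (π : CornerPart) : Finset (Finset (Sym2 (ℕ × ℕ))) :=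
  (edges n).powerset.filter fun S => IsForest n S π

theorem mem_forests {n : ℕ} {π : CornerPart} {S : Finset (Sym2 (ℕ × ℕ))} :
    S ∈ forests n π ↔ IsForest n S π := by
  classical
  rw [forests, Finset.mem_filter, Finset.mem_powerset, and_iff_right_iff_imp]
  exact IsForest.subset

/-- The total weight of the spanning forests of `SG(n)` of type `π`, where the weight of a forest is
the product of the weights `w` of its edges. -/
noncomputable def forestSum {R : Type*} [CommSemiring R] (w : Sym2 (ℕ × ℕ) → R) (n : ℕ)
    (π : CornerPart) : R :=
  ∑ S ∈ forests n π, ∏ e ∈ S, w e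

section ForestSum

variable {R : Type*} [CommSemiring R]

theorem forestSum_congr {w w' : Sym2 (ℕ × ℕ) → R} {n : ℕ} (h : ∀ e ∈ edges n, w e = w' e)
    (π : CornerPart) : forestSum w n π = forestSum w' n π :=
  Finset.sum_congr rfl fun _ hS =>
    Finset.prod_congr rfl fun e he => h e ((mem_forests.1 hS).subset he)

theorem forestSum_succ (w : Sym2 (ℕ × ℕ) → R) (n : ℕ) (π : CornerPart) :
    forestSum w (n + 1) π =
      ∑ ρ ∈ admissible π, ∏ i, forestSum (fun e => w (e.map (shift n i))) n (ρ i) := by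
  have hsubset {ρ : Fin 3 → CornerPart} {S : Fin 3 → Finset (Sym2 (ℕ × ℕ))}
      (hS : S ∈ Fintype.piFinset fun i => forests n (ρ i)) (i : Fin 3) : S i ⊆ edges n :=
    (mem_forests.1 (Fintype.mem_piFinset.1 hS i)).subset
  simp only [forestSum, Finset.prod_univ_sum]
  rw [Finset.sum_sigma']
  symm
  refine Finset.sum_nbij (fun ρS => glueEdges n ρS.2) ?_ ?_ ?_ ?_
  · rintro ⟨ρ, S⟩ h
    obtain ⟨hρ, hS⟩ := Finset.mem_sigma.1 h
    exact mem_forests.2 <| (isForest_glueEdges_iff (hsubset hS)).2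
      ⟨ρ, hρ, fun i => mem_forests.1 (Fintype.mem_piFinset.1 hS i)⟩
  · rintro ⟨ρ, S⟩ h ⟨ρ', S'⟩ h' hglue
    have hS : S ∈ Fintype.piFinset fun i => forests n (ρ i) := (Finset.mem_sigma.1 h).2
    have hS' : S' ∈ Fintype.piFinset fun i => forests n (ρ' i) := (Finset.mem_sigma.1 h').2
    obtain rfl : S = S' := by
      rw [← restrictEdges_glueEdges (hsubset hS), ← restrictEdges_glueEdges (hsubset hS')]
      exact congrArg (restrictEdges n) hglue
    obtain rfl : ρ = ρ' := funext fun i =>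
      (mem_forests.1 (Fintype.mem_piFinset.1 hS i)).toCovers.unique
        (mem_forests.1 (Fintype.mem_piFinset.1 hS' i)).toCovers
    rfl
  · intro S hS
    have hforest := mem_forests.1 hS
    have hglue := glueEdges_restrictEdges hforest.subset
    rw [← hglue] at hforest
    obtain ⟨ρ, hρ, h⟩ := (isForest_glueEdges_iff (restrictEdges_subset n S)).1 hforest
    exact ⟨⟨ρ, restrictEdges n S⟩, Finset.mem_coe.2 <| Finset.mem_sigma.2
      ⟨hρ, Fintype.mem_piFinset.2 fun i => mem_forests.2 (h i)⟩, hglue⟩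
  · rintro ⟨ρ, S⟩ h
    exact (prod_glueEdges (hsubset (Finset.mem_sigma.1 h).2) w).symm

end ForestSum

/-- The side of the triangle `SG(0)` opposite to corner `i`. -/
def oppositeSide (i : Fin 3) : Sym2 (ℕ × ℕ) := s(corner 0 (i + 1), corner 0 (i + 2))

instance decidableIsForestZero (S : (edges 0).powerset) (π : CornerPart) :
    Decidable (IsForest 0 S.1 π) :=
  decidable_of_iff (Covers 0 S.1 π ∧ S.1.card + π.blocks = 3)
    ⟨fun h => ⟨h.1, Finset.mem_powerset.1 S.2, h.2⟩, fun h => ⟨h.toCovers, h.card_eq⟩⟩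

theorem forests_zero_eq {π : CornerPart} {s : Finset (Finset (Sym2 (ℕ × ℕ)))}
    (hs : s ⊆ (edges 0).powerset) (h : ∀ S : (edges 0).powerset, IsForest 0 S.1 π ↔ S.1 ∈ s) :
    forests 0 π = s := by
  ext S
  rw [mem_forests]
  exact ⟨fun hS => (h ⟨S, Finset.mem_powerset.2 hS.subset⟩).1 hS, fun hS => (h ⟨S, hs hS⟩).2 hS⟩

theorem forests_zero_tree :
    forests 0 .tree =
      Finset.univ.image fun i => ({oppositeSide (i + 1), oppositeSide (i + 2)} : Finset _) :=
  forests_zero_eq (by decide +kernel) (by decide +kernel)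

theorem forests_zero_iso (i : Fin 3) : forests 0 (.iso i) = {{oppositeSide i}} :=
  forests_zero_eq (by revert i; decide +kernel) (by revert i; decide +kernel)

theorem forests_zero_discrete : forests 0 .discrete = {∅} :=
  forests_zero_eq (by decide +kernel) (by decide +kernel)

section ForestSumZero

variable {R : Type*} [CommSemiring R] (w : Sym2 (ℕ × ℕ) → R)

theorem forestSum_zero_tree :
    forestSum w 0 .tree = ∑ i, w (oppositeSide (i + 1)) * w (oppositeSide (i + 2)) := by
  have hinj : Function.Injective fun i : Fin 3 =>
      ({oppositeSide (i + 1), oppositeSide (i + 2)} : Finset _) := by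
    decide
  have hne : ∀ i : Fin 3, oppositeSide (i + 1) ≠ oppositeSide (i + 2) := by decide
  rw [forestSum, forests_zero_tree, Finset.sum_image hinj.injOn]
  exact Finset.sum_congr rfl fun i _ => Finset.prod_pair (hne i)

theorem forestSum_zero_iso (i : Fin 3) : forestSum w 0 (.iso i) = w (oppositeSide i) := by
  rw [forestSum, forests_zero_iso, Finset.sum_singleton, Finset.prod_singleton]

theorem forestSum_zero_discrete : forestSum w 0 .discrete = 1 := by
  rw [forestSum, forests_zero_discrete, Finset.sum_singleton, Finset.prod_empty]

end ForestSumZero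

section EdgeGraph

variable {n : ℕ} {S : Finset (Sym2 (ℕ × ℕ))}

/-- The spanning subgraph of `SG(n)` with edge set `S`. -/
def edgeGraph (n : ℕ) (S : Finset (Sym2 (ℕ × ℕ))) : SimpleGraph (Vertex n) :=
  (SimpleGraph.fromEdgeSet (S : Set (Sym2 (ℕ × ℕ)))).comap Subtype.val

theorem edgeGraph_adj (hS : S ⊆ edges n) {u v : Vertex n} :
    (edgeGraph n S).Adj u v ↔ s(u.1, v.1) ∈ S := by
  rw [edgeGraph, SimpleGraph.comap_adj, SimpleGraph.fromEdgeSet_adj, Finset.mem_coe,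
    and_iff_left_iff_imp]
  intro h huv
  exact not_isDiag_of_mem_edges (hS h) (Sym2.mk_isDiag_iff.2 huv)

theorem edgeGraph_le (hS : S ⊆ edges n) : edgeGraph n S ≤ SG n :=
  fun _ _ h => SimpleGraph.fromEdgeSet_mono (Finset.coe_subset.2 hS) h

theorem image_edgeSet_edgeGraph (hS : S ⊆ edges n) :
    Sym2.map Subtype.val '' (edgeGraph n S).edgeSet = (S : Set (Sym2 (ℕ × ℕ))) := by
  ext e
  constructor
  · rintro ⟨d, hd, rfl⟩
    induction d with
    | _ u v => exact (edgeGraph_adj hS).1 hd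
  · intro he
    induction e with
    | _ u v =>
      have hu := mem_verts_of_mem_edges (hS he) (Sym2.mem_mk_left u v)
      have hv := mem_verts_of_mem_edges (hS he) (Sym2.mem_mk_right u v)
      exact ⟨s(⟨u, hu⟩, ⟨v, hv⟩), (edgeGraph_adj (u := ⟨u, hu⟩) (v := ⟨v, hv⟩) hS).2 he, rfl⟩

theorem edgeGraph_injOn : Set.InjOn (edgeGraph n) {S | S ⊆ edges n} := by
  intro S hS S' hS' h
  rw [← Finset.coe_inj, ← image_edgeSet_edgeGraph hS, ← image_edgeSet_edgeGraph hS', h]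

theorem exists_edgeGraph_eq {T : SimpleGraph (Vertex n)} (hT : T ≤ SG n) :
    ∃ S ⊆ edges n, edgeGraph n S = T := by
  classical
  refine ⟨(edges n).filter fun e => e ∈ Sym2.map Subtype.val '' T.edgeSet,
    Finset.filter_subset _ _, ?_⟩
  ext u v
  rw [edgeGraph_adj (Finset.filter_subset _ _), Finset.mem_filter]
  constructor
  · rintro ⟨-, d, hd, h⟩
    obtain rfl : d = s(u, v) := Sym2.map.injective Subtype.val_injective h
    exact hd
  · intro h
    exact ⟨(edgeGraph_adj Finset.Subset.rfl).1 (hT h), s(u, v), h, rfl⟩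

theorem card_edgeSet_edgeGraph (hS : S ⊆ edges n) :
    Nat.card (edgeGraph n S).edgeSet = S.card := by
  rw [Nat.card_coe_set_eq, ← Set.ncard_image_of_injective _
    (Sym2.map.injective Subtype.val_injective), image_edgeSet_edgeGraph hS, Set.ncard_coe_finset]

theorem edgeGraph_reachable (hS : S ⊆ edges n) {u v : Vertex n} :
    (edgeGraph n S).Reachable u v ↔ Reach S u.1 v.1 := by
  rw [SimpleGraph.reachable_iff_reflTransGen]
  constructor
  · exact Relation.ReflTransGen.lift Subtype.val (fun _ _ h => (edgeGraph_adj hS).1 h) _ _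
  · intro h
    obtain ⟨v, hv⟩ := v
    dsimp only at h
    suffices ∃ hv : v ∈ verts n, Relation.ReflTransGen (edgeGraph n S).Adj u ⟨v, hv⟩ from this.2
    clear hv
    induction h with
    | refl => exact ⟨u.2, .refl⟩
    | tail _ h ih =>
      obtain ⟨hp, hup⟩ := ih
      exact ⟨mem_verts_of_mem_edges (hS h) (Sym2.mem_mk_right _ _),
        hup.tail ((edgeGraph_adj hS).2 h)⟩

theorem edgeGraph_isTree_iff (hS : S ⊆ edges n) :
    (edgeGraph n S).IsTree ↔ IsForest n S .tree := by
  rw [SimpleGraph.isTree_iff_connected_and_card, card_edgeSet_edgeGraph hS,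
    Nat.card_eq_fintype_card, Fintype.card_coe]
  constructor
  · rintro ⟨hconn, hcard⟩
    have hreach {u v : ℕ × ℕ} (hu : u ∈ verts n) (hv : v ∈ verts n) : Reach S u v :=
      (edgeGraph_reachable hS (u := ⟨u, hu⟩) (v := ⟨v, hv⟩)).1 (hconn.preconnected _ _)
    exact ⟨⟨fun v hv => ⟨0, hreach (corner_mem_verts n 0) hv⟩, fun j k =>
      iff_of_true (hreach (corner_mem_verts n j) (corner_mem_verts n k)) rfl⟩, hS, hcard⟩
  · intro h
    have hreach {v : ℕ × ℕ} (hv : v ∈ verts n) : Reach S (corner n 0) v := by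
      obtain ⟨j, hj⟩ := h.exists_corner v hv
      exact ((h.reach_iff 0 j).2 rfl).trans hj
    have : Nonempty (Vertex n) := ⟨⟨_, corner_mem_verts n 0⟩⟩
    exact ⟨⟨fun u v => (edgeGraph_reachable hS).2 ((hreach u.2).symm.trans (hreach v.2))⟩,
      h.card_eq⟩

theorem ncard_neighborSet_edgeGraph (hS : S ⊆ edges n) (x : Vertex n) :
    ((edgeGraph n S).neighborSet x).ncard = (S.filter fun e => x.1 ∈ e).card := by
  have hinj : Function.Injective fun v : Vertex n => s(x.1, v.1) := fun u v h =>
    Subtype.ext (Sym2.congr_right.1 h)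
  rw [← Set.ncard_image_of_injective _ hinj, ← Set.ncard_coe_finset]
  congr 1
  ext e
  simp only [Set.mem_image, SimpleGraph.mem_neighborSet, edgeGraph_adj hS, Finset.coe_filter,
    Set.mem_ofPred_eq]
  constructor
  · rintro ⟨v, hv, rfl⟩
    exact ⟨hv, Sym2.mem_mk_left _ _⟩
  · rintro ⟨he, hx⟩
    obtain ⟨v, rfl⟩ := Sym2.mem_iff_exists.1 hx
    exact ⟨⟨v, mem_verts_of_mem_edges (hS he) (Sym2.mem_mk_right _ _)⟩, he, rfl⟩

theorem edgeGraph_bijOn (n : ℕ) : Set.BijOn (edgeGraph n) (forests n .tree) (spanningTrees n) := by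
  refine ⟨fun S hS => ?_, edgeGraph_injOn.mono fun S hS => (mem_forests.1 hS).subset, ?_⟩
  · have hforest := mem_forests.1 hS
    exact ⟨edgeGraph_le hforest.subset, (edgeGraph_isTree_iff hforest.subset).2 hforest⟩
  · rintro T ⟨hle, htree⟩
    obtain ⟨S, hS, rfl⟩ := exists_edgeGraph_eq hle
    exact ⟨S, mem_forests.2 ((edgeGraph_isTree_iff hS).1 htree), rfl⟩

theorem f_eq_card (n : ℕ) : f n = (forests n .tree).card := by
  rw [f, ← (edgeGraph_bijOn n).ncard_eq, Set.ncard_coe_finset]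

theorem fdeg_eq_card (j n : ℕ) (x : Vertex n) :
    fdeg j n x = ((forests n .tree).filter fun S => (S.filter fun e => x.1 ∈ e).card = j).card := by
  have hbij := (edgeGraph_bijOn n).subset_right
    (Set.sep_subset (spanningTrees n) fun T => (T.neighborSet x).ncard = j)
  rw [fdeg, ← hbij.ncard_eq, ← Set.ncard_coe_finset, Finset.coe_filter]
  congr 1
  ext S
  refine and_congr_right fun hS => ?_
  rw [← ncard_neighborSet_edgeGraph (mem_forests.1 hS).subset]
  exact and_iff_right ((edgeGraph_bijOn n).mapsTo hS)

end EdgeGraph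

/-- The types `a`, `b`, `c` for the copies `i`, `i + 1`, `i + 2`. -/
def copyTypes (i : Fin 3) (a b c : CornerPart) (k : Fin 3) : CornerPart := ![a, b, c] (k - i)

open CornerPart in
/-- The elements of `admissible π`. -/
def gluings : CornerPart → List (Fin 3 → CornerPart)
  | tree => [0, 1, 2].flatMap fun i =>
      [copyTypes i (iso (i + 1)) tree tree, copyTypes i (iso (i + 2)) tree tree]
  | iso i =>
      [copyTypes i discrete tree tree, copyTypes i tree (iso i) (iso i),
        copyTypes i (iso i) tree (iso i), copyTypes i (iso i) tree (iso (i + 1)),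
        copyTypes i (iso (i + 1)) tree (iso i), copyTypes i (iso i) (iso i) tree,
        copyTypes i (iso i) (iso (i + 2)) tree, copyTypes i (iso (i + 2)) (iso i) tree]
  | discrete =>
      ([0, 1, 2].flatMap fun i =>
        [copyTypes i tree discrete (iso i), copyTypes i tree discrete (iso (i + 2)),
          copyTypes i tree (iso i) discrete, copyTypes i tree (iso (i + 1)) discrete,
          copyTypes i (iso i) (iso i) (iso (i + 1)), copyTypes i (iso i) (iso i) (iso (i + 2)),
          copyTypes i (iso i) (iso (i + 1)) (iso i), copyTypes i (iso i) (iso (i + 2)) (iso i)]) ++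
      [copyTypes 0 (iso 1) (iso 2) (iso 0), copyTypes 0 (iso 2) (iso 0) (iso 1)]

theorem nodup_gluings (π : CornerPart) : (gluings π).Nodup := by
  revert π
  decide +kernel

theorem toFinset_gluings (π : CornerPart) : (gluings π).toFinset = admissible π := by
  revert π
  decide +kernel

theorem sum_admissible {M : Type*} [AddCommMonoid M] (π : CornerPart)
    (g : (Fin 3 → CornerPart) → M) :
    ∑ ρ ∈ admissible π, g ρ = ((gluings π).map g).sum := by
  rw [← toFinset_gluings, List.sum_toFinset g (nodup_gluings π)]

theorem prod_mult_mul_copyTypes {R : Type*} [CommSemiring R] (u : Fin 3 → CornerPart → R)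
    (i : Fin 3) (a b c : CornerPart) :
    ∏ k, ((copyTypes i a b c k).mult : R) * u k (copyTypes i a b c k) =
      a.mult * u i a * (b.mult * u (i + 1) b) * (c.mult * u (i + 2) c) := by
  rw [← Equiv.prod_comp (Equiv.addLeft i), Fin.prod_univ_three]
  simp only [Equiv.coe_addLeft, copyTypes, sub_self, add_sub_cancel_left, add_zero,
    Matrix.cons_val]

/-- The total multiplicity of the gluings producing type `π`. -/
def gluingMult (π : CornerPart) : ℕ := ∑ ρ ∈ admissible π, ∏ i, (ρ i).mult

theorem gluingMult_eq (π : CornerPart) :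
    gluingMult π = match π with | .tree => 6 | .iso _ => 10 | .discrete => 50 := by
  rw [gluingMult, sum_admissible]
  revert π
  decide +kernel

theorem pow_mul_gluingMult (π : CornerPart) :
    5 * 3 ^ π.blocks * gluingMult π = 18 * 5 ^ π.blocks * π.mult := by
  rw [gluingMult_eq]
  cases π <;> rfl

section MeanWeight

variable {K : Type*} [Field K]

/-- The mean weight of a uniformly chosen spanning forest of `SG(n)` of type `π`. -/
noncomputable def meanWeight (w : Sym2 (ℕ × ℕ) → K) (n : ℕ) (π : CornerPart) : K :=
  forestSum w n π / forestSum (fun _ => 1) n π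

/-- The mean over the gluings that produce type `π`, chosen with probability proportional to
`∏ i, (ρ i).mult`, of the product of the values of `u i` at the type of copy `i`. -/
def glueMean (u : Fin 3 → CornerPart → K) (π : CornerPart) : K :=
  (∑ ρ ∈ admissible π, ∏ i, (ρ i).mult * u i (ρ i)) / gluingMult π

theorem meanWeight_congr {w w' : Sym2 (ℕ × ℕ) → K} {n : ℕ} (h : ∀ e ∈ edges n, w e = w' e) :
    meanWeight w n = meanWeight w' n := by
  funext π
  rw [meanWeight, meanWeight, forestSum_congr h]

/-- The law of the types of the three copies of a uniform forest of type `π` does not depend on the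
stage, because the powers of `T` and `r` are the same for all gluings that produce `π`. -/
theorem prod_forestSum_of_mem_admissible {N : CornerPart → K} {T r : K}
    (hN : ∀ π, N π = T * r ^ π.blocks * π.mult) {π : CornerPart} {ρ : Fin 3 → CornerPart}
    (hρ : ρ ∈ admissible π) :
    ∏ i, N (ρ i) = T ^ 3 * r ^ (3 + π.blocks) * ∏ i, ((ρ i).mult : K) := by
  simp only [hN, Finset.prod_mul_distrib, Finset.prod_const, Finset.card_univ, Fintype.card_fin,
    Finset.prod_pow_eq_pow_sum, (Finset.mem_filter.1 hρ).2.1]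

theorem exists_forestSum_one_eq [CharZero K] (n : ℕ) :
    ∃ T r : K, T ≠ 0 ∧ r ≠ 0 ∧
      ∀ π, forestSum (fun _ => 1) n π = T * r ^ π.blocks * π.mult := by
  induction n with
  | zero =>
    refine ⟨9, 1 / 3, by norm_num, by norm_num, fun π => ?_⟩
    cases π with
    | tree => rw [forestSum_zero_tree]; norm_num [CornerPart.blocks, CornerPart.mult]
    | iso i => rw [forestSum_zero_iso]; norm_num [CornerPart.blocks, CornerPart.mult]
    | discrete => rw [forestSum_zero_discrete]; norm_num [CornerPart.blocks, CornerPart.mult]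
  | succ n ih =>
    obtain ⟨T, r, hT, hr, hN⟩ := ih
    have hT' : 18 / 5 * T ^ 3 * r ^ 3 ≠ 0 :=
      mul_ne_zero (mul_ne_zero (by norm_num) (pow_ne_zero 3 hT)) (pow_ne_zero 3 hr)
    refine ⟨18 / 5 * T ^ 3 * r ^ 3, 5 / 3 * r, hT', mul_ne_zero (by norm_num) hr, fun π => ?_⟩
    rw [forestSum_succ, Finset.sum_congr rfl fun ρ hρ => prod_forestSum_of_mem_admissible hN hρ,
      ← Finset.mul_sum]
    have hmult : (5 : K) * 3 ^ π.blocks * gluingMult π = 18 * 5 ^ π.blocks * π.mult :=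
      mod_cast pow_mul_gluingMult π
    rw [gluingMult] at hmult
    push_cast at hmult
    have h3 : (3 : K) ^ π.blocks ≠ 0 := pow_ne_zero _ three_ne_zero
    rw [mul_pow, div_pow, pow_add]
    field_simp
    linear_combination hmult

theorem forestSum_one_ne_zero [CharZero K] (n : ℕ) (π : CornerPart) :
    forestSum (fun _ => (1 : K)) n π ≠ 0 := by
  obtain ⟨T, r, hT, hr, hN⟩ := exists_forestSum_one_eq (K := K) n
  have hmult : π.mult ≠ 0 := by cases π <;> simp [CornerPart.mult]
  rw [hN]
  exact mul_ne_zero (mul_ne_zero hT (pow_ne_zero _ hr)) (Nat.cast_ne_zero.2 hmult)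

theorem meanWeight_one [CharZero K] (n : ℕ) : meanWeight (fun _ => (1 : K)) n = 1 :=
  funext fun π => div_self (forestSum_one_ne_zero n π)

theorem meanWeight_succ [CharZero K] (w : Sym2 (ℕ × ℕ) → K) (n : ℕ) :
    meanWeight w (n + 1) = glueMean fun i => meanWeight (fun e => w (e.map (shift n i))) n := by
  funext π
  obtain ⟨T, r, hT, hr, hN⟩ := exists_forestSum_one_eq (K := K) n
  have hprod {ρ : Fin 3 → CornerPart} (hρ : ρ ∈ admissible π) :=
    prod_forestSum_of_mem_admissible hN hρ
  have hsum (w : Sym2 (ℕ × ℕ) → K) : forestSum w (n + 1) π = T ^ 3 * r ^ (3 + π.blocks) *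
      ∑ ρ ∈ admissible π,
        ∏ i, (ρ i).mult * meanWeight (fun e => w (e.map (shift n i))) n (ρ i) := by
    rw [forestSum_succ, Finset.mul_sum]
    refine Finset.sum_congr rfl fun ρ hρ => ?_
    rw [Finset.prod_mul_distrib, ← mul_assoc, ← hprod hρ, ← Finset.prod_mul_distrib]
    exact Finset.prod_congr rfl fun i _ => (mul_div_cancel₀ _ (forestSum_one_ne_zero n _)).symm
  have hfactor : T ^ 3 * r ^ (3 + π.blocks) ≠ 0 :=
    mul_ne_zero (pow_ne_zero _ hT) (pow_ne_zero _ hr)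
  rw [meanWeight, hsum, hsum, mul_div_mul_left _ _ hfactor, glueMean, gluingMult]
  simp only [meanWeight_one, Pi.one_apply, mul_one]
  push_cast
  rfl

end MeanWeight

section GlueMean

variable {K : Type*} [Field K]

open CornerPart

theorem glueMean_eq (u : Fin 3 → CornerPart → K) (π : CornerPart) :
    glueMean u π = ((gluings π).map fun ρ => ∏ i, (ρ i).mult * u i (ρ i)).sum / gluingMult π := by
  rw [glueMean, sum_admissible]

theorem glueMean_tree (u : Fin 3 → CornerPart → K) :
    glueMean u tree =
      (∑ i, (u i (iso (i + 1)) + u i (iso (i + 2))) * u (i + 1) tree * u (i + 2) tree) / 6 := by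
  simp only [glueMean_eq, gluingMult_eq, gluings, List.flatMap_cons, List.flatMap_nil,
    List.cons_append, List.nil_append, List.map_cons, List.map_nil, List.sum_cons, List.sum_nil,
    prod_mult_mul_copyTypes, Fin.sum_univ_three]
  simp only [mult]
  push_cast
  ring

theorem glueMean_iso (u : Fin 3 → CornerPart → K) (i : Fin 3) :
    glueMean u (iso i) =
      (3 * u i discrete * u (i + 1) tree * u (i + 2) tree +
        u i tree * u (i + 1) (iso i) * u (i + 2) (iso i) +
        u i (iso i) * u (i + 1) tree * (u (i + 2) (iso i) + u (i + 2) (iso (i + 1))) +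
        u i (iso i) * (u (i + 1) (iso i) + u (i + 1) (iso (i + 2))) * u (i + 2) tree +
        u i (iso (i + 1)) * u (i + 1) tree * u (i + 2) (iso i) +
        u i (iso (i + 2)) * u (i + 1) (iso i) * u (i + 2) tree) / 10 := by
  simp only [glueMean_eq, gluingMult_eq, gluings, List.map_cons, List.map_nil, List.sum_cons,
    List.sum_nil, prod_mult_mul_copyTypes]
  simp only [mult]
  push_cast
  ring

theorem glueMean_discrete (u : Fin 3 → CornerPart → K) :
    glueMean u discrete =
      (∑ i, (3 * u i tree * u (i + 1) discrete * (u (i + 2) (iso i) + u (i + 2) (iso (i + 2))) +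
          3 * u i tree * (u (i + 1) (iso i) + u (i + 1) (iso (i + 1))) * u (i + 2) discrete +
          u i (iso i) * u (i + 1) (iso i) * (u (i + 2) (iso (i + 1)) + u (i + 2) (iso (i + 2))) +
          u i (iso i) * (u (i + 1) (iso (i + 1)) + u (i + 1) (iso (i + 2))) * u (i + 2) (iso i)) +
        u 0 (iso 1) * u 1 (iso 2) * u 2 (iso 0) +
        u 0 (iso 2) * u 1 (iso 0) * u 2 (iso 1)) / 50 := by
  simp only [glueMean_eq, gluingMult_eq, gluings, List.flatMap_cons, List.flatMap_nil,
    List.cons_append, List.nil_append, List.map_cons, List.map_nil, List.sum_cons, List.sum_nil,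
    prod_mult_mul_copyTypes, Fin.sum_univ_three]
  simp only [mult]
  push_cast
  ring

theorem glueMean_mulSingle_tree (i : Fin 3) (v : CornerPart → K) :
    glueMean (Pi.mulSingle i v) tree = (4 * v tree + v (iso (i + 1)) + v (iso (i + 2))) / 6 := by
  rw [glueMean_tree, Fin.sum_univ_three]
  fin_cases i <;> simp only [Fin.zero_eta, Fin.mk_one, Fin.reduceFinMk, Fin.reduceAdd, Fin.reduceEq,
    zero_add, ne_eq, one_ne_zero, zero_ne_one, not_false_eq_true, Pi.mulSingle_eq_same,
    Pi.mulSingle_eq_of_ne, Pi.one_apply, mul_one] <;> ring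

theorem glueMean_mulSingle_iso_self (i : Fin 3) (v : CornerPart → K) :
    glueMean (Pi.mulSingle i v) (iso i) =
      (v tree + 4 * v (iso i) + v (iso (i + 1)) + v (iso (i + 2)) + 3 * v discrete) / 10 := by
  rw [glueMean_iso]
  simp only [Pi.mulSingle_eq_same, Pi.mulSingle_eq_of_ne, ne_eq, add_eq_left, one_ne_zero,
    Fin.reduceEq, not_false_eq_true, Pi.one_apply, mul_one]
  ring

theorem glueMean_mulSingle_iso_add_one (i : Fin 3) (v : CornerPart → K) :
    glueMean (Pi.mulSingle i v) (iso (i + 1)) =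
      (6 * v tree + 3 * v (iso (i + 1)) + v (iso (i + 2))) / 10 := by
  rw [glueMean_iso]
  fin_cases i <;> simp only [Fin.zero_eta, Fin.mk_one, Fin.reduceFinMk, Fin.reduceAdd, Fin.reduceEq,
    zero_add, ne_eq, one_ne_zero, zero_ne_one, not_false_eq_true, Pi.mulSingle_eq_same,
    Pi.mulSingle_eq_of_ne, Pi.one_apply, mul_one, one_mul] <;> ring

theorem glueMean_mulSingle_iso_add_two (i : Fin 3) (v : CornerPart → K) :
    glueMean (Pi.mulSingle i v) (iso (i + 2)) =
      (6 * v tree + v (iso (i + 1)) + 3 * v (iso (i + 2))) / 10 := by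
  rw [glueMean_iso]
  fin_cases i <;> simp only [Fin.zero_eta, Fin.mk_one, Fin.reduceFinMk, Fin.reduceAdd, Fin.reduceEq,
    zero_add, ne_eq, one_ne_zero, zero_ne_one, not_false_eq_true, Pi.mulSingle_eq_same,
    Pi.mulSingle_eq_of_ne, Pi.one_apply, mul_one, one_mul] <;> ring

theorem glueMean_mulSingle_discrete (i : Fin 3) (v : CornerPart → K) :
    glueMean (Pi.mulSingle i v) discrete =
      (12 * v tree + 12 * v (iso i) + 7 * v (iso (i + 1)) + 7 * v (iso (i + 2)) +
        12 * v discrete) / 50 := by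
  rw [glueMean_discrete, Fin.sum_univ_three]
  fin_cases i <;> simp only [Fin.zero_eta, Fin.mk_one, Fin.reduceFinMk, Fin.reduceAdd, Fin.reduceEq,
    zero_add, ne_eq, one_ne_zero, zero_ne_one, not_false_eq_true, Pi.mulSingle_eq_same,
    Pi.mulSingle_eq_of_ne, Pi.one_apply, mul_one, one_mul] <;> ring

end GlueMean

section MarkedCopy

variable {K : Type*} [Field K] [CharZero K] {w : Sym2 (ℕ × ℕ) → K} {n : ℕ}

theorem meanWeight_succ_of_eq_one {i : Fin 3}
    (hw : ∀ j ≠ i, ∀ e ∈ edges n, w (e.map (shift n j)) = 1) :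
    meanWeight w (n + 1) =
      glueMean (Pi.mulSingle i (meanWeight (fun e => w (e.map (shift n i))) n)) := by
  rw [meanWeight_succ]
  congr 1
  funext j
  rcases eq_or_ne j i with rfl | hj
  · rw [Pi.mulSingle_eq_same]
  · rw [Pi.mulSingle_eq_of_ne hj, meanWeight_congr (hw j hj), meanWeight_one]

/-- Average of the mean weights of the two forest types that isolate the right and the top corner.
For weights supported in the left copy, it evolves together with the mean weight of trees. -/
noncomputable def isoMean (w : Sym2 (ℕ × ℕ) → K) (n : ℕ) : K :=
  (meanWeight w n (.iso 1) + meanWeight w n (.iso 2)) / 2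

theorem meanWeight_add (hw : ∀ N ≥ n, ∀ i ≠ 0, ∀ e ∈ edges N, w (e.map (shift N i)) = 1) (m : ℕ) :
    meanWeight w (n + m) .tree = (9 * meanWeight w n .tree + 5 * isoMean w n) / 14 +
        5 / 14 * (meanWeight w n .tree - isoMean w n) * (1 / 15) ^ m ∧
      isoMean w (n + m) = (9 * meanWeight w n .tree + 5 * isoMean w n) / 14 -
        9 / 14 * (meanWeight w n .tree - isoMean w n) * (1 / 15) ^ m := by
  induction m with
  | zero =>
    simp only [add_zero, pow_zero]
    constructor <;> ring
  | succ m ih =>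
    obtain ⟨htree, hiso⟩ := ih
    have hstep := meanWeight_succ_of_eq_one (hw (n + m) (Nat.le_add_right n m))
    simp only [shift_zero, id_eq, Sym2.map_id'] at hstep
    have htree_step : meanWeight w (n + m + 1) .tree =
        (2 * meanWeight w (n + m) .tree + isoMean w (n + m)) / 3 := by
      rw [hstep, glueMean_mulSingle_tree, zero_add, zero_add, isoMean]
      ring
    have hiso_step : isoMean w (n + m + 1) =
        (3 * meanWeight w (n + m) .tree + 2 * isoMean w (n + m)) / 5 := by
      have h1 := glueMean_mulSingle_iso_add_one 0 (meanWeight w (n + m))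
      have h2 := glueMean_mulSingle_iso_add_two 0 (meanWeight w (n + m))
      rw [zero_add, zero_add] at h1 h2
      rw [isoMean, hstep, h1, h2, isoMean]
      ring
    rw [← add_assoc, htree_step, hiso_step, htree, hiso]
    constructor <;> ring

end MarkedCopy

section PointWeight

variable {K : Type*} [Field K]

/-- The weight `y` on the edges at the point `p`, and `1` on all others: the weight of a forest is
then `y` to the power of the degree of `p`. -/
def pointWeight (y : K) (p : ℕ × ℕ) (e : Sym2 (ℕ × ℕ)) : K := if p ∈ e then y else 1

theorem pointWeight_map_shift (y : K) (n : ℕ) (i : Fin 3) (u : ℕ × ℕ) :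
    (fun e => pointWeight y (shift n i u) (e.map (shift n i))) = pointWeight y u := by
  funext e
  have hmem : shift n i u ∈ e.map (shift n i) ↔ u ∈ e := by
    simp only [Sym2.mem_map, (shift_injective n i).eq_iff, exists_eq_right]
  simp only [pointWeight, hmem]

theorem pointWeight_map_shift_of_ne (y : K) {n : ℕ} {i : Fin 3} {p : ℕ × ℕ}
    (hp : ∀ u ∈ verts n, shift n i u ≠ p) {e : Sym2 (ℕ × ℕ)} (he : e ∈ edges n) :
    pointWeight y p (e.map (shift n i)) = 1 := by
  refine if_neg fun h => ?_
  obtain ⟨u, hu, rfl⟩ := Sym2.mem_map.1 h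
  exact hp u (mem_verts_of_mem_edges he hu) rfl

theorem shift_ne_shift_corner {n : ℕ} {i j k : Fin 3} (hki : k ≠ i) (hkj : k ≠ j) {u : ℕ × ℕ}
    (hu : u ∈ verts n) : shift n k u ≠ shift n i (corner n j) := fun h =>
  hkj (corner_injective n (eq_corner_of_shift_eq hki hu (corner_mem_verts n j) h).2).symm

theorem shift_ne_of_lt {n : ℕ} {i : Fin 3} (hi : i ≠ 0) {p : ℕ × ℕ} (h1 : p.1 < 2 ^ n)
    (h2 : p.2 < 2 ^ n) (u : ℕ × ℕ) : shift n i u ≠ p := by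
  rintro rfl
  fin_cases i
  · exact hi rfl
  · exact absurd h1 (by simp [shift, corner_one])
  · exact absurd h2 (by simp [shift, corner_two])

open CornerPart in
/-- The mean weight of a forest of `SG(n)`, as a function of its type, when the edges at corner `c`
have weight `y`. The bases `1`, `1 / 15`, `3 / 5` and `1 / 25` are the eigenvalues of the linear
recursion `v ↦ glueMean (Pi.mulSingle c v)` on the `v` symmetric in the two other corners. -/
def cornerMean (y : K) (n : ℕ) (c : Fin 3) : CornerPart → K
  | tree => y * (11 + 3 * y) / 14 - 5 / 42 * y * (1 - y) * (1 / 15) ^ n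
  | iso i =>
      if i = c then
        y * (11 + 3 * y) / 14 - 2 / 7 * y * (1 - y) * (1 / 15) ^ n +
          3 / 28 * (1 - y) * (11 + 3 * y) * (3 / 5) ^ n - 5 / 28 * (1 - y) ^ 2 * (1 / 25) ^ n
      else y * (11 + 3 * y) / 14 + 3 / 14 * y * (1 - y) * (1 / 15) ^ n
  | discrete =>
      y * (11 + 3 * y) / 14 + 3 / 14 * y * (1 - y) * (1 / 15) ^ n +
        1 / 14 * (1 - y) * (11 + 3 * y) * (3 / 5) ^ n + 3 / 14 * (1 - y) ^ 2 * (1 / 25) ^ n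

variable [CharZero K]

theorem meanWeight_corner_zero (y : K) (c : Fin 3) :
    meanWeight (pointWeight y (corner 0 c)) 0 = cornerMean y 0 c := by
  have hside (i : Fin 3) : corner 0 c ∈ oppositeSide i ↔ c ≠ i := by
    revert c i
    decide
  funext π
  cases π with
  | tree =>
    rw [meanWeight, forestSum_zero_tree, forestSum_zero_tree]
    simp only [Fin.sum_univ_three, pointWeight, hside]
    fin_cases c <;> simp only [Fin.zero_eta, Fin.mk_one, Fin.reduceFinMk, Fin.reduceAdd,
      Fin.reduceEq, zero_add, ne_eq, one_ne_zero, zero_ne_one, not_true_eq_false,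
      not_false_eq_true, if_true, if_false, mul_one, one_mul, cornerMean, pow_zero] <;> ring
  | iso i =>
    rw [meanWeight, forestSum_zero_iso, forestSum_zero_iso]
    rcases eq_or_ne c i with rfl | hi
    · simp only [pointWeight, hside, cornerMean, ne_eq, not_true_eq_false, if_true, if_false,
        div_one, pow_zero]
      ring
    · simp only [pointWeight, hside, cornerMean, ne_eq, hi, hi.symm, not_false_eq_true, if_true,
        if_false, div_one, pow_zero]
      ring
  | discrete =>
    rw [meanWeight, forestSum_zero_discrete, forestSum_zero_discrete]
    simp only [cornerMean, div_one, pow_zero]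
    ring

theorem glueMean_mulSingle_cornerMean (y : K) (n : ℕ) (c : Fin 3) :
    glueMean (Pi.mulSingle c (cornerMean y n c)) = cornerMean y (n + 1) c := by
  funext π
  cases π with
  | tree =>
    rw [glueMean_mulSingle_tree]
    simp only [cornerMean, add_eq_left, one_ne_zero, Fin.reduceEq, if_false, pow_succ]
    ring
  | iso i =>
    have hi : i = c ∨ i = c + 1 ∨ i = c + 2 := by
      revert i c
      decide
    rcases hi with rfl | rfl | rfl
    · rw [glueMean_mulSingle_iso_self]
      simp only [cornerMean, add_eq_left, one_ne_zero, Fin.reduceEq, if_true, if_false, pow_succ]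
      ring
    · rw [glueMean_mulSingle_iso_add_one]
      simp only [cornerMean, add_eq_left, one_ne_zero, Fin.reduceEq, if_false, pow_succ]
      ring
    · rw [glueMean_mulSingle_iso_add_two]
      simp only [cornerMean, add_eq_left, one_ne_zero, Fin.reduceEq, if_false, pow_succ]
      ring
  | discrete =>
    rw [glueMean_mulSingle_discrete]
    simp only [cornerMean, add_eq_left, one_ne_zero, Fin.reduceEq, if_true, if_false, pow_succ]
    ring

theorem meanWeight_corner (y : K) (n : ℕ) (c : Fin 3) :
    meanWeight (pointWeight y (corner n c)) n = cornerMean y n c := by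
  induction n with
  | zero => exact meanWeight_corner_zero y c
  | succ n ih =>
    rw [← shift_corner_self, meanWeight_succ_of_eq_one fun j hj e he =>
      pointWeight_map_shift_of_ne y (fun u hu => shift_ne_shift_corner hj hj hu) he,
      pointWeight_map_shift, ih, glueMean_mulSingle_cornerMean]

theorem meanWeight_shift_corner (y : K) (n : ℕ) {i j : Fin 3} (hij : i ≠ j) :
    meanWeight (pointWeight y (shift n i (corner n j))) (n + 1) =
      glueMean (Pi.mulSingle i (cornerMean y n j) * Pi.mulSingle j (cornerMean y n i)) := by
  rw [meanWeight_succ]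
  congr 1
  funext k
  rw [Pi.mul_apply]
  rcases eq_or_ne k i with rfl | hki
  · rw [pointWeight_map_shift, meanWeight_corner, Pi.mulSingle_eq_same,
      Pi.mulSingle_eq_of_ne hij, mul_one]
  rcases eq_or_ne k j with rfl | hkj
  · rw [shift_corner_comm, pointWeight_map_shift, meanWeight_corner, Pi.mulSingle_eq_same,
      Pi.mulSingle_eq_of_ne hki, one_mul]
  · rw [Pi.mulSingle_eq_of_ne hki, Pi.mulSingle_eq_of_ne hkj, one_mul, ← meanWeight_one n]
    exact meanWeight_congr fun e he => pointWeight_map_shift_of_ne y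
      (fun u hu => shift_ne_shift_corner hki hkj hu) he

theorem meanWeight_pointWeight_add (y : K) {n : ℕ} {p : ℕ × ℕ} (h1 : p.1 < 2 ^ n)
    (h2 : p.2 < 2 ^ n) (m : ℕ) :
    meanWeight (pointWeight y p) (n + m) .tree =
      (9 * meanWeight (pointWeight y p) n .tree + 5 * isoMean (pointWeight y p) n) / 14 +
        5 / 14 * (meanWeight (pointWeight y p) n .tree - isoMean (pointWeight y p) n) *
          (1 / 15) ^ m := by
  refine (meanWeight_add (fun N hN i hi e he => pointWeight_map_shift_of_ne y
    (fun u _ => shift_ne_of_lt hi ?_ ?_ u) he) m).1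
  · exact h1.trans_le (Nat.pow_le_pow_right two_pos hN)
  · exact h2.trans_le (Nat.pow_le_pow_right two_pos hN)

theorem one_div_pow_eq_mul_pow (n : ℕ) :
    (1 / 25 : K) ^ n = (3 / 5) ^ n * (1 / 15) ^ n ∧
      (1 / 375 : K) ^ n = (3 / 5) ^ n * (1 / 15) ^ n * (1 / 15) ^ n ∧
      (1 / 225 : K) ^ n = (1 / 15) ^ n * (1 / 15) ^ n := by
  simp only [← mul_pow]
  norm_num

theorem meanWeight_a (y : K) (n m : ℕ) :
    meanWeight (pointWeight y (a n m).1) (n + m + 1) .tree =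
      y ^ 2 * (11 + 3 * y) ^ 2 / 196 + 15 / 5488 * y * (1 - y) * (11 + 3 * y) ^ 2 * (3 / 5) ^ n -
        9 / 1372 * y * (1 - y) ^ 2 * (11 + 3 * y) * (1 / 25) ^ n +
        55 / 16464 * y * (1 - y) ^ 3 * (1 / 375) ^ n -
        11 / 1176 * y ^ 2 * (1 - y) * (11 + 3 * y) * (1 / 15) ^ n +
        1 / 294 * y ^ 2 * (1 - y) ^ 2 * (1 / 225) ^ n +
        (1 / 15) ^ m * (-1 / 5488 * y * (1 - y) * (11 + 3 * y) ^ 2 * (3 / 5) ^ n -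
          2 / 1029 * y * (1 - y) ^ 2 * (11 + 3 * y) * (1 / 25) ^ n +
          185 / 49392 * y * (1 - y) ^ 3 * (1 / 375) ^ n -
          13 / 3528 * y ^ 2 * (1 - y) * (11 + 3 * y) * (1 / 15) ^ n +
          11 / 2646 * y ^ 2 * (1 - y) ^ 2 * (1 / 225) ^ n) := by
  have ha : (a n m).1 = shift n 0 (corner n 1) := by rw [shift_zero, corner_one, a, id_eq]
  have hlt : (2 : ℕ) ^ n < 2 ^ (n + 1) := Nat.pow_lt_pow_right one_lt_two n.lt_succ_self
  obtain ⟨h25, h375, h225⟩ := one_div_pow_eq_mul_pow (K := K) n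
  rw [ha, add_right_comm, meanWeight_pointWeight_add y (ha ▸ hlt) (by simp [← ha, a]), isoMean,
    meanWeight_shift_corner y n (by decide), glueMean_tree, glueMean_iso, glueMean_iso,
    Fin.sum_univ_three, h25, h375, h225]
  simp only [cornerMean, h25, Pi.mul_apply, Pi.one_apply, Pi.mulSingle_eq_same,
    Pi.mulSingle_eq_of_ne, ne_eq, zero_ne_one, Fin.reduceEq, Fin.reduceAdd, zero_add,
    not_false_eq_true, if_true, if_false, mul_one, one_mul]
  ring

theorem meanWeight_c (y : K) (n m : ℕ) :
    meanWeight (pointWeight y (c n m).1) (n + m + 1) .tree =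
      y ^ 2 * (11 + 3 * y) ^ 2 / 196 + 9 / 2744 * y * (1 - y) * (11 + 3 * y) ^ 2 * (3 / 5) ^ n -
        2 / 343 * y * (1 - y) ^ 2 * (11 + 3 * y) * (1 / 25) ^ n +
        5 / 8232 * y * (1 - y) ^ 3 * (1 / 375) ^ n -
        5 / 588 * y ^ 2 * (1 - y) * (11 + 3 * y) * (1 / 15) ^ n +
        (1 / 15) ^ m * (-1 / 1372 * y * (1 - y) * (11 + 3 * y) ^ 2 * (3 / 5) ^ n -
          11 / 4116 * y * (1 - y) ^ 2 * (11 + 3 * y) * (1 / 25) ^ n +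
          20 / 3087 * y * (1 - y) ^ 3 * (1 / 375) ^ n -
          2 / 441 * y ^ 2 * (1 - y) * (11 + 3 * y) * (1 / 15) ^ n +
          10 / 1323 * y ^ 2 * (1 - y) ^ 2 * (1 / 225) ^ n) := by
  have hc : (c n m).1 = shift n 1 (corner n 2) := by
    simp [c, shift, corner_one, corner_two]
  have hlt : (2 : ℕ) ^ n < 2 ^ (n + 1) := Nat.pow_lt_pow_right one_lt_two n.lt_succ_self
  obtain ⟨h25, h375, h225⟩ := one_div_pow_eq_mul_pow (K := K) n
  rw [hc, add_right_comm, meanWeight_pointWeight_add y (hc ▸ hlt) (hc ▸ hlt), isoMean,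
    meanWeight_shift_corner y n (by decide), glueMean_tree, glueMean_iso, glueMean_iso,
    Fin.sum_univ_three, h25, h375, h225]
  simp only [cornerMean, h25, Pi.mul_apply, Pi.one_apply, Pi.mulSingle_eq_same,
    Pi.mulSingle_eq_of_ne, ne_eq, zero_ne_one, Fin.reduceEq, Fin.reduceAdd, zero_add,
    not_false_eq_true, if_true, if_false, mul_one, one_mul]
  ring

end PointWeight

section DegreeLaw

open Polynomial

/-- The generating function of the degree of `p` in a spanning tree of `SG(n)`. -/
noncomputable def degreePolynomial (n : ℕ) (p : ℕ × ℕ) : ℝ[X] :=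
  ∑ S ∈ forests n .tree, X ^ (S.filter (p ∈ ·)).card

theorem coeff_degreePolynomial (j n : ℕ) (x : Vertex n) :
    (degreePolynomial n x.1).coeff j = fdeg j n x := by
  simp only [degreePolynomial, finsetSum_coeff, coeff_X_pow, Finset.sum_boole, fdeg_eq_card,
    eq_comm]

theorem eval_degreePolynomial (y : ℝ) (n : ℕ) (p : ℕ × ℕ) :
    (degreePolynomial n p).eval y = forestSum (pointWeight y p) n .tree := by
  simp only [degreePolynomial, eval_finsetSum, eval_pow, eval_X, forestSum, pointWeight,
    Finset.prod_ite, Finset.prod_const, one_pow, mul_one]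

theorem F_eq_coeff {n : ℕ} {x : Vertex n} {Q : ℝ[X]}
    (hQ : ∀ y, meanWeight (pointWeight y x.1) n .tree = Q.eval y) (j : ℕ) :
    F j n x = Q.coeff j := by
  have hf : forestSum (fun _ => (1 : ℝ)) n .tree = f n := by
    simp only [forestSum, Finset.prod_const_one, Finset.sum_const, nsmul_one, f_eq_card]
  have hpoly : degreePolynomial n x.1 * C (f n : ℝ)⁻¹ = Q := by
    refine Polynomial.funext fun y => ?_
    rw [← hQ, eval_mul, eval_C, eval_degreePolynomial, meanWeight, hf, div_eq_mul_inv]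
  rw [← hpoly, coeff_mul_C, coeff_degreePolynomial, F, div_eq_mul_inv]

theorem F_eq_of_meanWeight_eq {n : ℕ} {x : Vertex n} {q₁ q₂ q₃ q₄ : ℝ}
    (h : ∀ y, meanWeight (pointWeight y x.1) n .tree =
      q₁ * y + q₂ * y ^ 2 + q₃ * y ^ 3 + q₄ * y ^ 4) :
    F 1 n x = q₁ ∧ F 2 n x = q₂ ∧ F 3 n x = q₃ ∧ F 4 n x = q₄ := by
  have hQ (y : ℝ) : meanWeight (pointWeight y x.1) n .tree =
      (C q₁ * X + C q₂ * X ^ 2 + C q₃ * X ^ 3 + C q₄ * X ^ 4).eval y := by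
    simp only [h, eval_add, eval_mul, eval_C, eval_X, eval_pow]
  refine ⟨?_, ?_, ?_, ?_⟩ <;> rw [F_eq_coeff hQ] <;> simp

end DegreeLaw

end SierpinskiGasket

open SierpinskiGasket in
theorem mainTheorem3 (n m : ℕ) :
    F 1 (n + m + 1) (a n m) =
        1815 / 5488 * (3 / 5) ^ n - 99 / 1372 * (1 / 25) ^ n + 55 / 16464 * (1 / 375) ^ n
        + (1 / 15) ^ m *
          (-121 / 5488 * (3 / 5) ^ n - 22 / 1029 * (1 / 25) ^ n + 185 / 49392 * (1 / 375) ^ n) ∧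
    F 2 (n + m + 1) (a n m) =
        121 / 196 - 825 / 5488 * (3 / 5) ^ n + 171 / 1372 * (1 / 25) ^ n
        - 55 / 5488 * (1 / 375) ^ n - 121 / 1176 * (1 / 15) ^ n + 1 / 294 * (1 / 225) ^ n
        + (1 / 15) ^ m *
          (55 / 5488 * (3 / 5) ^ n + 38 / 1029 * (1 / 25) ^ n
            - 185 / 16464 * (1 / 375) ^ n - 143 / 3528 * (1 / 15) ^ n + 11 / 2646 * (1 / 225) ^ n) ∧
    F 3 (n + m + 1) (a n m) =
        33 / 98 - 855 / 5488 * (3 / 5) ^ n - 45 / 1372 * (1 / 25) ^ n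
        + 55 / 5488 * (1 / 375) ^ n + 11 / 147 * (1 / 15) ^ n - 1 / 147 * (1 / 225) ^ n
        + (1 / 15) ^ m *
          (57 / 5488 * (3 / 5) ^ n - 10 / 1029 * (1 / 25) ^ n
            + 185 / 16464 * (1 / 375) ^ n + 13 / 441 * (1 / 15) ^ n - 11 / 1323 * (1 / 225) ^ n) ∧
    F 4 (n + m + 1) (a n m) =
        9 / 196 - 135 / 5488 * (3 / 5) ^ n - 27 / 1372 * (1 / 25) ^ n
        - 55 / 16464 * (1 / 375) ^ n + 11 / 392 * (1 / 15) ^ n + 1 / 294 * (1 / 225) ^ n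
        + (1 / 15) ^ m *
          (9 / 5488 * (3 / 5) ^ n - 2 / 343 * (1 / 25) ^ n
            - 185 / 49392 * (1 / 375) ^ n + 13 / 1176 * (1 / 15) ^ n + 11 / 2646 * (1 / 225) ^ n) ∧
    F 1 (n + m + 1) (c n m) =
        1089 / 2744 * (3 / 5) ^ n - 22 / 343 * (1 / 25) ^ n + 5 / 8232 * (1 / 375) ^ n
        + (1 / 15) ^ m *
          (-121 / 1372 * (3 / 5) ^ n - 121 / 4116 * (1 / 25) ^ n + 20 / 3087 * (1 / 375) ^ n) ∧
    F 2 (n + m + 1) (c n m) =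
        121 / 196 - 495 / 2744 * (3 / 5) ^ n + 38 / 343 * (1 / 25) ^ n
        - 5 / 2744 * (1 / 375) ^ n - 55 / 588 * (1 / 15) ^ n
        + (1 / 15) ^ m *
          (55 / 1372 * (3 / 5) ^ n + 209 / 4116 * (1 / 25) ^ n
            - 20 / 1029 * (1 / 375) ^ n - 22 / 441 * (1 / 15) ^ n + 10 / 1323 * (1 / 225) ^ n) ∧
    F 3 (n + m + 1) (c n m) =
        33 / 98 - 513 / 2744 * (3 / 5) ^ n - 10 / 343 * (1 / 25) ^ n
        + 5 / 2744 * (1 / 375) ^ n + 10 / 147 * (1 / 15) ^ n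
        + (1 / 15) ^ m *
          (57 / 1372 * (3 / 5) ^ n - 55 / 4116 * (1 / 25) ^ n
            + 20 / 1029 * (1 / 375) ^ n + 16 / 441 * (1 / 15) ^ n - 20 / 1323 * (1 / 225) ^ n) ∧
    F 4 (n + m + 1) (c n m) =
        9 / 196 - 81 / 2744 * (3 / 5) ^ n - 6 / 343 * (1 / 25) ^ n
        - 5 / 8232 * (1 / 375) ^ n + 5 / 196 * (1 / 15) ^ n
        + (1 / 15) ^ m *
          (9 / 1372 * (3 / 5) ^ n - 11 / 1372 * (1 / 25) ^ n
            - 20 / 3087 * (1 / 375) ^ n + 2 / 147 * (1 / 15) ^ n + 10 / 1323 * (1 / 225) ^ n) := by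
  have and_and_iff {p₁ p₂ p₃ p₄ q : Prop} :
      (p₁ ∧ p₂ ∧ p₃ ∧ p₄) ∧ q ↔ p₁ ∧ p₂ ∧ p₃ ∧ p₄ ∧ q := by
    simp only [and_assoc]
  refine and_and_iff.1 ⟨F_eq_of_meanWeight_eq fun y => ?_, F_eq_of_meanWeight_eq fun y => ?_⟩
  · rw [meanWeight_a]
    ring
  · rw [meanWeight_c]
    ring
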